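/- Let $\mathbb K\in\{\mathbb R,\mathbb C\}$. For subsets $V,U$ of a $\mathbb K$-vector space $X$ and $n\in\mathbb N_0$ let \[ \delta_n(V,U)=\inf\{\delta>0:\ V\subseteq \delta U+L \text{ for some subspace } L\subseteq X \text{ with } \dim L\le n\}\in[0,\infty] \] ($\inf\emptyset=\infty$) be the $n$-th Kolmogorov width. For a locally convex space $X$ let $\mathcal U_0(X)$ be the system of its absolutely convex $0$-neighbourhoods and $\mathcal B(X)$ the system of its bounded subsets, and define the sets of real sequences \begin{align*} \Delta(X)&=\{\xi\in\mathbb R^{\mathbb N_0}: \forall U\in\mathcal U_0(X)\ \exists V\in\mathcal U_0(X):\ \xi_n\delta_n(V,U)\to0\},\\ \Delta_b(X)&=\{\xi\in\mathbb R^{\mathbb N_0}: \forall U\in\mathcal U_0(X)\ \forall B\in\mathcal B(X):\ \xi_n\delta_n(B,U)\to0\},\\ \Delta^\infty(X)&=\{\xi\in\mathbb R^{\mathbb N_0}: \forall U\in\mathcal U_0(X)\ \exists V\in\mathcal U_0(X):\ (\xi_n\delta_n(V,U))_n\text{ is bounded}\},\\ \Delta_b^\infty(X)&=\{\xi\in\mathbb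 R^{\mathbb N_0}: \forall U\in\mathcal U_0(X)\ \forall B\in\mathcal B(X):\ (\xi_n\delta_n(B,U))_n\text{ is bounded}\}, \end{align*} where $0\cdot\infty=0$. A locally convex space $X$ is a Schwartz space if every $U\in\mathcal U_0(X)$ contains some $V\in\mathcal U_0(X)$ which is precompact with respect to $U$ (for every $\varepsilon>0$ there is a finite set $F\subseteq X$ with $V\subseteq F+\varepsilon U$). It is hilbertizable if it has a fundamental system of continuous seminorms of the form $x\mapsto\langle x,x\rangle^{1/2}$ with semi-scalar products $\langle\cdot,\cdot\rangle$ on $X$. It is nuclear if for every continuous seminorm $p$ there is a continuous seminorm $q\ge p$ such that the canonical map $X_q\to X_p$ between the Hausdorff completions of $(X,q)$ and $(X,p)$ is nuclear, i.e. of the form $x\mapsto\sum_j a_j(x)y_j$ with $a_j\in X_q'$, $y_j\in X_p$ and $\sum_j\|a_j\|\,\|y_j\|<\infty$. A Fréchet space is a complete metrizable locally convex space. **Theorem.** For every hilbertizable Fréchet–Schwartz space $X$, \[ \Delta(X)=\Delta_b(X)=\Delta^\infty(X)=\Delta_b^\infty(X). \] In particular, these equalities hold for every nuclear Fréchet space $X$.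 -/

import Mathlib

open Filter Topology Pointwise
open scoped ENNReal

namespace DiametralDimension

section Widths

variable (𝕜 : Type*) [RCLike 𝕜] {X : Type*} [AddCommGroup X] [Module 𝕜 X] [Module ℝ X]

/-- The `n`-th Kolmogorov width `δ_n(V, U)`: the infimum of all `δ > 0` such that
`V ⊆ δ U + L` for some at most `n`-dimensional subspace `L` of `X`. It is an extended
nonnegative real, equal to `∞` if there is no such `δ`. -/
noncomputable def kolmogorovWidth (n : ℕ) (V U : Set X) : ℝ≥0∞ :=
  sInf (ENNReal.ofReal '' {δ : ℝ | 0 < δ ∧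
    ∃ L : Submodule 𝕜 X, Module.rank 𝕜 L ≤ n ∧ V ⊆ δ • U + (L : Set X)})

end Widths

section Dimensions

variable (𝕜 : Type*) [RCLike 𝕜] (X : Type*) [AddCommGroup X] [Module 𝕜 X] [Module ℝ X]
  [TopologicalSpace X]

/-- The system of all absolutely convex neighbourhoods of `0`. -/
def absConvexNhds : Set (Set X) :=
  {U | U ∈ 𝓝 (0 : X) ∧ Balanced 𝕜 U ∧ Convex ℝ U}

/-- The diametral dimension `Δ(X)`. -/
def diamDim : Set (ℕ → ℝ) :=
  {ξ | ∀ U ∈ absConvexNhds 𝕜 X, ∃ V ∈ absConvexNhds 𝕜 X,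
    Tendsto (fun n => ‖ξ n‖ₑ * kolmogorovWidth 𝕜 n V U) atTop (𝓝 0)}

/-- The variant `Δ_b(X)`, defined with the bounded subsets of `X`. -/
def diamDimB : Set (ℕ → ℝ) :=
  {ξ | ∀ U ∈ absConvexNhds 𝕜 X, ∀ B : Set X, Bornology.IsVonNBounded 𝕜 B →
    Tendsto (fun n => ‖ξ n‖ₑ * kolmogorovWidth 𝕜 n B U) atTop (𝓝 0)}

/-- The variant `Δ^∞(X)`: boundedness instead of convergence to `0`. -/
def diamDimInfty : Set (ℕ → ℝ) :=
  {ξ | ∀ U ∈ absConvexNhds 𝕜 X, ∃ V ∈ absConvexNhds 𝕜 X,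
    ∃ C : ℝ≥0∞, C < ∞ ∧ ∀ n, ‖ξ n‖ₑ * kolmogorovWidth 𝕜 n V U ≤ C}

/-- The variant `Δ_b^∞(X)`. -/
def diamDimBInfty : Set (ℕ → ℝ) :=
  {ξ | ∀ U ∈ absConvexNhds 𝕜 X, ∀ B : Set X, Bornology.IsVonNBounded 𝕜 B →
    ∃ C : ℝ≥0∞, C < ∞ ∧ ∀ n, ‖ξ n‖ₑ * kolmogorovWidth 𝕜 n B U ≤ C}

/-- Schwartz spaces: every absolutely convex `0`-neighbourhood `U` contains another one, `V`,
which is precompact with respect to `U`. -/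
def IsSchwartzSpace : Prop :=
  ∀ U ∈ absConvexNhds 𝕜 X, ∃ V ∈ absConvexNhds 𝕜 X, V ⊆ U ∧
    ∀ ε : ℝ, 0 < ε → ∃ F : Set X, F.Finite ∧ V ⊆ F + ε • U

end Dimensions

section Hilbertizable

/-- A seminorm `p` is a Hilbert seminorm if it is given by a semi-scalar product:
`p x ^ 2 = ⟨x, x⟩`. -/
def IsHilbertSeminorm {𝕜 X : Type*} [RCLike 𝕜] [AddCommGroup X] [Module 𝕜 X]
    (p : Seminorm 𝕜 X) : Prop :=
  ∃ c : PreInnerProductSpace.Core 𝕜 X, ∀ x, p x ^ 2 = RCLike.re (c.inner x x)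

/-- A locally convex space is hilbertizable if it has a fundamental system of continuous
seminorms that are given by semi-scalar products. -/
def IsHilbertizable (𝕜 X : Type*) [RCLike 𝕜] [AddCommGroup X] [Module 𝕜 X]
    [TopologicalSpace X] : Prop :=
  ∀ q : Seminorm 𝕜 X, Continuous q →
    ∃ p : Seminorm 𝕜 X, Continuous p ∧ IsHilbertSeminorm p ∧ q ≤ p

end Hilbertizable

section Nuclear

/-- A continuous linear map between normed spaces is nuclear if it can be written as
`x ↦ ∑ a_j(x) y_j` with continuous functionals `a_j` and `∑ ‖a_j‖ ‖y_j‖ < ∞`. -/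
def IsNuclearMap {𝕜 E F : Type*} [RCLike 𝕜] [NormedAddCommGroup E] [NormedSpace 𝕜 E]
    [NormedAddCommGroup F] [NormedSpace 𝕜 F] (T : E →L[𝕜] F) : Prop :=
  ∃ (a : ℕ → (E →L[𝕜] 𝕜)) (y : ℕ → F), Summable (fun j => ‖a j‖ * ‖y j‖) ∧
    ∀ x, HasSum (fun j => a j x • y j) (T x)

variable {𝕜 X : Type*} [RCLike 𝕜] [AddCommGroup X] [Module 𝕜 X]

/-- The space `X` endowed with the seminorm `p`. -/
def SeminormedCopy (_p : Seminorm 𝕜 X) : Type _ := X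

noncomputable instance (p : Seminorm 𝕜 X) : SeminormedAddCommGroup (SeminormedCopy p) :=
  AddGroupSeminorm.toSeminormedAddCommGroup (E := X) p.toAddGroupSeminorm

noncomputable instance (p : Seminorm 𝕜 X) : Module 𝕜 (SeminormedCopy p) :=
  inferInstanceAs (Module 𝕜 X)

noncomputable instance (p : Seminorm 𝕜 X) : NormedSpace 𝕜 (SeminormedCopy p) where
  norm_smul_le a x := (map_smul_eq_mul p a x).le

/-- The local Banach space of `p`: the Hausdorff completion of `X` endowed with `p`. -/
abbrev LocalBanach (p : Seminorm 𝕜 X) : Type _ := UniformSpace.Completion (SeminormedCopy p)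

/-- The identity `(X, q) → (X, p)` for `p ≤ q`. -/
noncomputable def idCopy {p q : Seminorm 𝕜 X} (h : p ≤ q) :
    SeminormedCopy q →L[𝕜] SeminormedCopy p :=
  LinearMap.mkContinuous
    { toFun := fun x => x
      map_add' := fun _ _ => rfl
      map_smul' := fun _ _ => rfl } 1 (fun x => by rw [one_mul]; exact h x)

/-- The canonical map between the local Banach spaces of seminorms `p ≤ q`: the continuous
extension of the identity of `X`. -/
noncomputable def canonicalMap {p q : Seminorm 𝕜 X} (h : p ≤ q) :
    LocalBanach q →L[𝕜] LocalBanach p :=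
  (UniformSpace.Completion.toComplL.comp (idCopy h)).extend UniformSpace.Completion.toComplL

theorem canonicalMap_coe {p q : Seminorm 𝕜 X} (h : p ≤ q) (x : SeminormedCopy q) :
    canonicalMap h (x : LocalBanach q) = ((idCopy h x : SeminormedCopy p) : LocalBanach p) :=
  ContinuousLinearMap.extend_eq _ UniformSpace.Completion.denseRange_coe
    (UniformSpace.Completion.isUniformInducing_coe _) x

/-- A locally convex space is nuclear if for every continuous seminorm `p` there is a
continuous seminorm `q ≥ p` such that the canonical map between the local Banach spaces of `q`
and `p` is nuclear. -/
def IsNuclearSpace (𝕜 X : Type*) [RCLike 𝕜] [AddCommGroup X] [Module 𝕜 X]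
    [TopologicalSpace X] : Prop :=
  ∀ p : Seminorm 𝕜 X, Continuous p →
    ∃ (q : Seminorm 𝕜 X) (h : p ≤ q), Continuous q ∧ IsNuclearMap (canonicalMap h)

end Nuclear

end DiametralDimension

/-!
The inclusions `Δ ⊆ Δ_b ⊆ Δ_b^∞` and `Δ ⊆ Δ^∞ ⊆ Δ_b^∞` are elementary and hold in every locally
convex space, so the content of the theorem is `Δ_b^∞ ⊆ Δ` (`diamDimBInfty_subset_diamDim`).

For Hilbert seminorms `p ≤ q` such that the unit ball of `q` is precompact for `p`, the widths are
singular values. Only two consequences are needed. By the finite-dimensional spectral theorem, if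
the `n`-th width exceeds `2 s`, then `p ≥ s q` on an `(n + 1)`-dimensional subspace on which `q` is
a norm (`IsPrecompactFor.hasLargeSubspace_or`). Conversely, any set containing the `q`-unit ball of
such a subspace has `n`-th width at least `s` (`ofReal_le_kolmogorovWidth`). The subspaces are taken
in `X` itself, so no completions are involved.

Assume `ξ ∉ Δ`, witnessed by a neighbourhood with Hilbert seminorm `p₀`, and choose Hilbert
seminorms `p₁ ≤ P 0 ≤ P 1 ≤ …` above `p₀` such that the unit ball of `p₁` is precompact for `p₀` and
the `P k` are fundamental. For each `k`, the products of `ξ n` with the widths of the `P k`-unit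
ball with respect to `p₀` do not tend to `0`. Since `p₀` is much smaller than `p₁` off a
finite-dimensional subspace, passing from `p₀` to `p₁` improves failure of convergence to
unboundedness, without a shift of the index (`IsPrecompactFor.hasLargeSubspace_gain`). So there
are subspaces `E k` of dimension larger than `n k` with `p₁ ≥ s k • P k` on `E k` and
`|ξ (n k)| s k > k`. The union of the `P k`-unit balls of the `E k` is bounded in `X`, because each
`E k` is finite-dimensional and the `P k` increase (`isVonNBounded_iUnion_unitBall`). Its widths
with respect to `p₁` show that `ξ ∉ Δ_b^∞`.

Nuclear spaces are both hilbertizable and Schwartz: a nuclear representation yields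
`p x ≤ ∑ c j * ‖φ j x‖` with `∑ c j < ∞` and functionals `φ j` bounded by `q`, which is dominated by
a Hilbert seminorm through the Cauchy-Schwarz inequality and is approximated by its finite partial
sums, uniformly on the unit ball of `q`.
-/

namespace DiametralDimension

/-! ### Precompact seminorms and orthonormal families -/

section Precompact

universe u

variable {𝕜 : Type*} {X : Type u} [RCLike 𝕜] [AddCommGroup X] [Module 𝕜 X]

/-- The unit ball of the seminorm `q` is precompact with respect to the seminorm `p`. -/
def IsPrecompactFor (p q : Seminorm 𝕜 X) : Prop :=
  ∀ ε : ℝ, 0 < ε → ∃ F : Finset X, ∀ x, q x ≤ 1 → ∃ y ∈ F, p (x - y) ≤ ε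

theorem IsPrecompactFor.mono {p p' q q' : Seminorm 𝕜 X} (h : IsPrecompactFor p q)
    (hp : p' ≤ p) (hq : q ≤ q') : IsPrecompactFor p' q' := by
  intro ε hε
  obtain ⟨F, hF⟩ := h ε hε
  refine ⟨F, fun x hx => ?_⟩
  obtain ⟨y, hy, hxy⟩ := hF x ((hq x).trans hx)
  exact ⟨y, hy, (hp _).trans hxy⟩

/-- A Hilbert seminorm has the form `x ↦ ‖A x‖` with a linear map `A` into a semi-inner product
space, namely the identity of `X` into the copy of `X` that carries the semi-scalar product. -/
theorem IsHilbertSeminorm.exists_linearMap {p : Seminorm 𝕜 X} (hp : IsHilbertSeminorm p) :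
    ∃ (H : Type u) (_ : SeminormedAddCommGroup H) (_ : InnerProductSpace 𝕜 H) (A : X →ₗ[𝕜] H),
      p = (normSeminorm 𝕜 H).comp A := by
  obtain ⟨c, hc⟩ := hp
  let I : InnerProductSpace 𝕜 (SeminormedCopy p) :=
    { inner := c.inner
      norm_sq_eq_re_inner := hc
      conj_inner_symm := c.conj_inner_symm
      add_left := c.add_left
      smul_left := c.smul_left }
  let A : X →ₗ[𝕜] SeminormedCopy p :=
    { toFun := fun x => x, map_add' := fun _ _ => rfl, map_smul' := fun _ _ => rfl }
  exact ⟨SeminormedCopy p, inferInstance, I, A, rfl⟩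

end Precompact

section Orthonormal

variable {𝕜 X H : Type*} [RCLike 𝕜] [AddCommGroup X] [Module 𝕜 X]
  [SeminormedAddCommGroup H] [InnerProductSpace 𝕜 H]

/-- The inductive step in the construction of long orthonormal families on which `p` is larger
than `ε`. -/
theorem exists_orthonormal_cons {p : Seminorm 𝕜 X} {B : X →ₗ[𝕜] H} (hpB : ∀ x, p x ≤ ‖B x‖)
    {ε : ℝ} {m : ℕ} {f : Fin m → X} (hf : Orthonormal 𝕜 (B ∘ f))
    (hε : 0 ≤ ε) (hfp : ∀ i, ε < p (f i)) {x : X} (hx : ∀ i, inner 𝕜 (B (f i)) (B x) = 0)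
    (hpx : ε * ‖B x‖ < p x) :
    ∃ g : Fin (m + 1) → X, Orthonormal 𝕜 (B ∘ g) ∧ ∀ i, ε < p (g i) := by
  have h0 : 0 < ‖B x‖ := by
    have h1 : 0 < p x := lt_of_le_of_lt (by positivity) hpx
    exact h1.trans_le (hpB x)
  set r : 𝕜 := ((‖B x‖⁻¹ : ℝ) : 𝕜) with hr
  have hnr : ‖r‖ = ‖B x‖⁻¹ := by rw [hr, RCLike.norm_ofReal, abs_of_pos (by positivity)]
  refine ⟨Fin.cons (r • x) f, ⟨?_, ?_⟩, ?_⟩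
  · intro i
    refine Fin.cases ?_ (fun j => ?_) i
    · simp only [Function.comp_apply, Fin.cons_zero, map_smul, norm_smul, hnr]
      exact inv_mul_cancel₀ h0.ne'
    · simpa using hf.1 j
  · intro i j hij
    induction i using Fin.cases with
    | zero =>
      induction j using Fin.cases with
      | zero => exact absurd rfl hij
      | succ j =>
        simp only [Function.comp_apply, Fin.cons_zero, Fin.cons_succ, map_smul]
        rw [inner_smul_left, ← inner_conj_symm, hx j]; simp
    | succ i =>
      induction j using Fin.cases with
      | zero =>
        simp only [Function.comp_apply, Fin.cons_zero, Fin.cons_succ, map_smul]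
        rw [inner_smul_right, hx i]; simp
      | succ j =>
        have := hf.2 (i := i) (j := j) (fun h => hij (by rw [h]))
        simpa using this
  · intro i
    refine Fin.cases ?_ (fun j => ?_) i
    · simp only [Fin.cons_zero, map_smul_eq_mul, hnr]
      rw [inv_mul_eq_div, lt_div_iff₀ h0]
      exact hpx
    · simpa using hfp j

/-- Orthonormal families on which a precompact seminorm stays away from `0` have bounded length:
a sum of `k` members that are close to each other has norm `√k`, but its seminorm is of
order `k`. -/
theorem IsPrecompactFor.exists_card_lt {p : Seminorm 𝕜 X} {B : X →ₗ[𝕜] H}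
    (hpB : ∀ x, p x ≤ ‖B x‖) (h : IsPrecompactFor p ((normSeminorm 𝕜 H).comp B))
    {ε : ℝ} (hε : 0 < ε) :
    ∃ M : ℕ, ∀ m (f : Fin m → X), Orthonormal 𝕜 (B ∘ f) → (∀ i, ε < p (f i)) → m ≤ M := by
  classical
  obtain ⟨F, hF⟩ := h (ε / 4) (by positivity)
  -- `k` members near a common `z` give `k * (ε / 2) ≤ √k`, that is, `k ≤ 4 / ε ^ 2`
  obtain ⟨N, hN⟩ := exists_nat_gt (4 / ε ^ 2)
  refine ⟨F.card * N, fun m f hf hfp => ?_⟩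
  by_contra! hm
  have hF' : ∀ i, ∃ y ∈ F, p (f i - y) ≤ ε / 4 := fun i => by
    refine hF _ ?_
    simpa using (hf.1 i).le
  choose y hyF hy using hF'
  obtain ⟨z, -, hz⟩ := Finset.exists_lt_card_fiber_of_mul_lt_card_of_maps_to
    (s := (Finset.univ : Finset (Fin m))) (t := F) (f := y) (n := N) (fun i _ => hyF i)
    (by simpa using hm)
  set S : Finset (Fin m) := {x | y x = z} with hS
  have hyz : ∀ i ∈ S, p (f i - z) ≤ ε / 4 := fun i hi => by
    have : y i = z := by simpa [hS] using hi
    exact this ▸ hy i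
  have hSpos : 0 < S.card := by omega
  obtain ⟨i0, hi0⟩ := Finset.card_pos.1 hSpos
  have hpz : 3 / 4 * ε ≤ p z := by
    have h1 := hyz i0 hi0
    have h2 := hfp i0
    have h3 : p (f i0) ≤ p (f i0 - z) + p z := by simpa using map_add_le_add p (f i0 - z) z
    linarith
  have hsum : p (∑ i ∈ S, (f i - z)) ≤ S.card * (ε / 4) :=
    (Finset.le_sum_of_subadditive p (map_zero p).le (map_add_le_add p) _ _).trans
      ((Finset.sum_le_sum hyz).trans (by simp))
  have hlow : S.card * (ε / 2) ≤ p (∑ i ∈ S, f i) := by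
    have h1 : (S.card : 𝕜) • z = ∑ i ∈ S, f i - ∑ i ∈ S, (f i - z) := by
      rw [Finset.sum_sub_distrib, Finset.sum_const, sub_sub_cancel, Nat.cast_smul_eq_nsmul]
    have h2 : S.card * p z ≤ p (∑ i ∈ S, f i) + p (∑ i ∈ S, (f i - z)) := by
      have := map_sub_le_add p (∑ i ∈ S, f i) (∑ i ∈ S, (f i - z))
      rw [← h1, map_smul_eq_mul] at this
      simpa using this
    have h3 : (S.card : ℝ) * (3 / 4 * ε) ≤ S.card * p z := by gcongr
    linarith
  have hup : p (∑ i ∈ S, f i) ^ 2 ≤ S.card := by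
    have h1 : ‖B (∑ i ∈ S, f i)‖ ^ 2 = S.card := by
      have h2 := hf.inner_sum (fun _ => (1 : 𝕜)) (fun _ => (1 : 𝕜)) S
      rw [map_sum, ← inner_self_eq_norm_sq (𝕜 := 𝕜)]
      simp only [one_smul, Function.comp_apply] at h2
      rw [h2]; simp
    calc _ ≤ ‖B (∑ i ∈ S, f i)‖ ^ 2 := by gcongr; exact hpB _
      _ = _ := h1
  have hcard : (S.card : ℝ) * (ε / 2) ^ 2 ≤ 1 := by
    have h1 : ((S.card : ℝ) * (ε / 2)) ^ 2 ≤ S.card :=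
      le_trans (by gcongr) hup
    have h2 : (0 : ℝ) < S.card := by exact_mod_cast hSpos
    refine le_of_mul_le_mul_left ?_ h2
    calc _ = ((S.card : ℝ) * (ε / 2)) ^ 2 := by ring
      _ ≤ _ := by simpa using h1
  have hNS : (N : ℝ) < S.card := by exact_mod_cast hz
  rw [div_lt_iff₀ (by positivity)] at hN
  nlinarith [mul_lt_mul_of_pos_right hNS (by positivity : 0 < ε ^ 2)]

/-- If the unit ball of `x ↦ ‖B x‖` is precompact with respect to `p`, then `p` is small compared
to it on the orthogonal complement of a finite orthonormal family. -/
theorem IsPrecompactFor.exists_orthonormal {p : Seminorm 𝕜 X} {B : X →ₗ[𝕜] H}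
    (hpB : ∀ x, p x ≤ ‖B x‖) (h : IsPrecompactFor p ((normSeminorm 𝕜 H).comp B))
    {ε : ℝ} (hε : 0 < ε) :
    ∃ (m : ℕ) (f : Fin m → X), Orthonormal 𝕜 (B ∘ f) ∧
      ∀ x, (∀ i, inner 𝕜 (B (f i)) (B x) = 0) → p x ≤ ε * ‖B x‖ := by
  by_contra! hcon
  have key : ∀ m, ∃ f : Fin m → X, Orthonormal 𝕜 (B ∘ f) ∧ ∀ i, ε < p (f i) := by
    intro m
    induction m with
    | zero => exact ⟨Fin.elim0, ⟨fun i => i.elim0, fun i => i.elim0⟩, fun i => i.elim0⟩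
    | succ m ih =>
      obtain ⟨f, hf, hfp⟩ := ih
      obtain ⟨x, hx, hpx⟩ := hcon m f hf
      exact exists_orthonormal_cons hpB hf hε.le hfp hx hpx
  obtain ⟨M, hM⟩ := h.exists_card_lt hpB hε
  obtain ⟨f, hf, hfp⟩ := key (M + 1)
  have := hM _ f hf hfp
  omega

end Orthonormal

/-! ### Finite-dimensional singular value decomposition -/

section Gram

variable {𝕜 X H K : Type*} [RCLike 𝕜] [AddCommGroup X] [Module 𝕜 X]
  [SeminormedAddCommGroup H] [InnerProductSpace 𝕜 H]
  [SeminormedAddCommGroup K] [InnerProductSpace 𝕜 K]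

/-- Diagonalising the Gram matrix of `A ∘ f` makes the images under `A` orthogonal without
changing the span of `f` or the orthonormality of the images under `B`. -/
theorem exists_orthonormal_orthogonal (A : X →ₗ[𝕜] K) {B : X →ₗ[𝕜] H} {m : ℕ} {f : Fin m → X}
    (hf : Orthonormal 𝕜 (B ∘ f)) :
    ∃ e : Fin m → X, Orthonormal 𝕜 (B ∘ e) ∧
      (∀ i j, i ≠ j → inner 𝕜 (A (e i)) (A (e j)) = 0) ∧
      ∀ x, (∀ i, inner 𝕜 (B (e i)) x = 0) → ∀ i, inner 𝕜 (B (f i)) x = 0 := by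
  have hG : (Matrix.gram 𝕜 (A ∘ f)).IsHermitian := Matrix.isHermitian_gram _ _
  set b := hG.eigenvectorBasis with hb
  let Φ : EuclideanSpace 𝕜 (Fin m) →ₗ[𝕜] X :=
    (Fintype.linearCombination 𝕜 f).comp (WithLp.linearEquiv 2 𝕜 (Fin m → 𝕜)).toLinearMap
  have hΦ : ∀ a, Φ a = ∑ j, a j • f j := fun a => by
    simp [Φ, Fintype.linearCombination_apply]
  have hBΦ : ∀ a a', inner 𝕜 (B (Φ a)) (B (Φ a')) = inner 𝕜 a a' := fun a a' => by
    have := hf.inner_sum (fun i => a i) (fun i => a' i) Finset.univ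
    simp only [Function.comp_apply] at this
    simp only [hΦ, map_sum, map_smul, this, PiLp.inner_apply, RCLike.inner_apply, mul_comm]
  refine ⟨fun i => Φ (b i), ?_, ?_, ?_⟩
  · rw [orthonormal_iff_ite]
    intro i j
    simp only [Function.comp_apply, hBΦ]
    exact orthonormal_iff_ite.1 b.orthonormal i j
  · intro i j hij
    have h1 := Matrix.star_dotProduct_gram_mulVec (𝕜 := 𝕜) (A ∘ f) (b i) (b j)
    rw [hb, hG.mulVec_eigenvectorBasis, dotProduct_smul] at h1
    have h2 : inner 𝕜 (b i) (b j) = 0 := b.orthonormal.2 hij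
    rw [PiLp.inner_apply] at h2
    have h3 : star (⇑(b i)) ⬝ᵥ ⇑(b j) = 0 := by
      rw [← h2]; simp [dotProduct, mul_comm]
    rw [← hb, h3, smul_zero] at h1
    simp only [hΦ, map_sum, map_smul]
    exact h1.symm
  · intro x hx i
    have h1 : ∀ a, inner 𝕜 (B (Φ a)) x = 0 := fun a => by
      rw [← b.sum_repr a]
      simp only [map_sum, map_smul, sum_inner, inner_smul_left, hx, mul_zero,
        Finset.sum_const_zero]
    have h2 := h1 (EuclideanSpace.single i 1)
    have h3 : Φ (EuclideanSpace.single i 1) = f i := by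
      rw [hΦ, Finset.sum_eq_single i] <;> simp +contextual
    rwa [h3] at h2

theorem norm_sq_sum_smul_of_orthogonal {ι : Type*} {v : ι → K} {S : Finset ι}
    (hv : ∀ i j, i ≠ j → inner 𝕜 (v i) (v j) = 0) (c : ι → 𝕜) :
    ‖∑ i ∈ S, c i • v i‖ ^ 2 = ∑ i ∈ S, ‖c i‖ ^ 2 * ‖v i‖ ^ 2 := by
  classical
  rw [← inner_self_eq_norm_sq (𝕜 := 𝕜), sum_inner, map_sum]
  refine Finset.sum_congr rfl fun i hi => ?_
  rw [inner_sum, Finset.sum_eq_single i]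
  · rw [inner_self_eq_norm_sq, norm_smul, mul_pow]
  · intro j _ hj
    rw [inner_smul_left, inner_smul_right, hv i j hj.symm]; simp
  · exact fun h => absurd hi h

end Gram

section LargeSubspace

variable {𝕜 X : Type*} [RCLike 𝕜] [AddCommGroup X] [Module 𝕜 X]

/-- There is an at least `(n + 1)`-dimensional subspace on which `q` is a norm and `p` is at
least `s • q`. For Hilbert seminorms the supremum of such `s` is the `n`-th singular value of the
canonical map from `(X, q)` to `(X, p)`. -/
def HasLargeSubspace (p q : Seminorm 𝕜 X) (n : ℕ) (s : ℝ) : Prop :=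
  ∃ E : Submodule 𝕜 X, n < Module.finrank 𝕜 E ∧ (∀ x ∈ E, q x = 0 → x = 0) ∧
    ∀ x ∈ E, s * q x ≤ p x

/-- A weak form of the singular value decomposition: either `p ≥ s • q` on an
`(n + 1)`-dimensional subspace, or the unit ball of `q` is within distance `2 s` of an
`n`-dimensional subspace. -/
theorem IsPrecompactFor.hasLargeSubspace_or {p q : Seminorm 𝕜 X} (hp : IsHilbertSeminorm p)
    (hq : IsHilbertSeminorm q) (hpq : p ≤ q) (h : IsPrecompactFor p q) (n : ℕ) {s : ℝ}
    (hs : 0 < s) :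
    HasLargeSubspace p q n s ∨ ∃ L : Submodule 𝕜 X, Module.rank 𝕜 L ≤ n ∧
      ∀ x, q x ≤ 1 → ∃ l ∈ L, p (x - l) ≤ 2 * s := by
  obtain ⟨K, _, _, A, rfl⟩ := hp.exists_linearMap
  obtain ⟨H, _, _, B, rfl⟩ := hq.exists_linearMap
  obtain ⟨m, f, hf, hfs⟩ := h.exists_orthonormal (fun x => hpq x) hs
  obtain ⟨e, he, heA, hef⟩ := exists_orthonormal_orthogonal A hf
  have hB : ∀ (S : Finset (Fin m)) (c : Fin m → 𝕜),
      ‖B (∑ i ∈ S, c i • e i)‖ ^ 2 = ∑ i ∈ S, ‖c i‖ ^ 2 := fun S c => by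
    have := norm_sq_sum_smul_of_orthogonal (𝕜 := 𝕜) (v := B ∘ e) (S := S)
      (fun i j hij => he.2 hij) c
    have he1 : ∀ i, ‖B (e i)‖ = 1 := he.1
    simpa [he1] using this
  have hA : ∀ (S : Finset (Fin m)) (c : Fin m → 𝕜),
      ‖A (∑ i ∈ S, c i • e i)‖ ^ 2 = ∑ i ∈ S, ‖c i‖ ^ 2 * ‖A (e i)‖ ^ 2 := fun S c => by
    simpa using norm_sq_sum_smul_of_orthogonal (𝕜 := 𝕜) (v := A ∘ e) (S := S) heA c
  -- the `‖A (e i)‖` are singular values; `I` collects the large ones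
  set I : Finset (Fin m) := {i | s ≤ ‖A (e i)‖} with hI
  rcases lt_or_ge n I.card with hn | hn
  · left
    have hli : LinearIndependent 𝕜 e := LinearIndependent.of_comp B he.linearIndependent
    have hmem : ∀ x ∈ Submodule.span 𝕜 (e '' I), ∃ c : Fin m → 𝕜, x = ∑ i ∈ I, c i • e i :=
      fun x hx => by
        obtain ⟨c, hc⟩ := (Submodule.mem_span_image_finset_iff_exists_fun' 𝕜).1 hx
        exact ⟨c, hc.symm⟩
    refine ⟨Submodule.span 𝕜 (e '' I), ?_, ?_, ?_⟩
    · have : Module.finrank 𝕜 (Submodule.span 𝕜 (e '' I)) = I.card := by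
        have h1 := finrank_span_eq_card (hli.comp (fun i : I => (i : Fin m))
          Subtype.val_injective)
        rw [Set.range_comp, Subtype.range_coe_subtype, Finset.setOfPred_mem] at h1
        rw [h1, Fintype.card_coe]
      rwa [this]
    · intro x hx hqx
      obtain ⟨c, rfl⟩ := hmem x hx
      have h1 : ‖B (∑ i ∈ I, c i • e i)‖ = 0 := hqx
      have h2 := hB I c
      rw [h1, zero_pow two_ne_zero, eq_comm,
        Finset.sum_eq_zero_iff_of_nonneg (fun i _ => by positivity)] at h2
      refine Finset.sum_eq_zero fun i hi => ?_
      have : c i = 0 := by simpa using h2 i hi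
      rw [this, zero_smul]
    · intro x hx
      obtain ⟨c, rfl⟩ := hmem x hx
      refine le_of_sq_le_sq ?_ (apply_nonneg _ _)
      change (s * ‖B _‖) ^ 2 ≤ ‖A _‖ ^ 2
      rw [mul_pow, hB, hA, Finset.mul_sum]
      refine Finset.sum_le_sum fun i hi => ?_
      have : s ≤ ‖A (e i)‖ := by simpa [hI] using hi
      rw [mul_comm]
      gcongr
  · right
    refine ⟨Submodule.span 𝕜 (e '' I), ?_, ?_⟩
    · classical
      rw [← Finset.coe_image]
      exact (rank_span_finset_le _).trans (by exact_mod_cast Finset.card_image_le.trans hn)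
    · intro x hx
      have hx : ‖B x‖ ≤ 1 := hx
      set c : Fin m → 𝕜 := fun i => inner 𝕜 (B (e i)) (B x) with hc
      have hbes : ∑ i, ‖c i‖ ^ 2 ≤ 1 :=
        (he.sum_inner_products_le (B x)).trans (pow_le_one₀ (norm_nonneg _) hx)
      refine ⟨∑ i ∈ I, c i • e i,
        Submodule.sum_mem _ fun i hi => Submodule.smul_mem _ _ (Submodule.subset_span ⟨i, hi, rfl⟩),
        ?_⟩
      -- the small singular values and the part `r` of `x` orthogonal to all `e i` cost `s` each
      set r := x - ∑ i, c i • e i with hr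
      have hrorth : ∀ i, inner 𝕜 (B (e i)) (B r) = 0 := fun i => by
        have h1 := he.inner_right_fintype c i
        simp only [Function.comp_apply] at h1
        rw [hr, map_sub, inner_sub_right, map_sum]
        simp only [map_smul]
        rw [h1, sub_self]
      have hBr : ‖B r‖ ≤ 1 := by
        have h1 : B x = B r + B (∑ i, c i • e i) := by rw [hr, map_sub]; abel
        have h2 : inner 𝕜 (B r) (B (∑ i, c i • e i)) = 0 := by
          simp only [map_sum, map_smul, inner_sum, inner_smul_right]
          refine Finset.sum_eq_zero fun i _ => ?_
          rw [← inner_conj_symm, hrorth]; simp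
        have h3 := norm_add_sq_eq_norm_sq_add_norm_sq_of_inner_eq_zero _ _ h2
        rw [← h1] at h3
        nlinarith [norm_nonneg (B r), norm_nonneg (B x), norm_nonneg (B (∑ i, c i • e i))]
      have hpr : ‖A r‖ ≤ s := by
        have h1 : ‖A r‖ ≤ s * ‖B r‖ := hfs r (hef _ hrorth)
        nlinarith
      have hpc : ‖A (∑ i ∈ Iᶜ, c i • e i)‖ ≤ s := by
        refine le_of_sq_le_sq ?_ hs.le
        rw [hA]
        calc _ ≤ ∑ i ∈ Iᶜ, ‖c i‖ ^ 2 * s ^ 2 := by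
              refine Finset.sum_le_sum fun i hi => ?_
              have : ‖A (e i)‖ ≤ s := by
                have : ¬ s ≤ ‖A (e i)‖ := by simpa [hI] using hi
                exact (not_le.1 this).le
              gcongr
          _ ≤ (∑ i, ‖c i‖ ^ 2) * s ^ 2 := by
              rw [← Finset.sum_mul]
              gcongr
              exact Finset.subset_univ _
          _ ≤ s ^ 2 := mul_le_of_le_one_left (by positivity) hbes
      have hsplit : x - ∑ i ∈ I, c i • e i = r + ∑ i ∈ Iᶜ, c i • e i := by
        rw [hr, ← Finset.sum_add_sum_compl I]; abel
      rw [hsplit]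
      change ‖A _‖ ≤ _
      rw [map_add]
      linarith [norm_add_le (A r) (A (∑ i ∈ Iᶜ, c i • e i))]

end LargeSubspace

/-! ### Lower bounds of seminorms on large subspaces -/

section Subspaces

variable {𝕜 X H : Type*} [RCLike 𝕜] [AddCommGroup X] [Module 𝕜 X]

/-- On a finite-dimensional subspace on which `q` is a norm, every seminorm is dominated by a
multiple of `q`. -/
theorem exists_le_mul_of_finiteDimensional (q r : Seminorm 𝕜 X) (E : Submodule 𝕜 X)
    [FiniteDimensional 𝕜 E] (hq : ∀ x ∈ E, q x = 0 → x = 0) :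
    ∃ C : ℝ, 0 < C ∧ ∀ x ∈ E, r x ≤ C * q x := by
  let q' : Seminorm 𝕜 E := q.comp E.subtype
  have : T0Space (SeminormedCopy q') := ⟨fun x y hxy => by
    have h1 : q' (x - y : E) = 0 := by
      have := Metric.inseparable_iff.1 hxy
      rwa [dist_eq_norm] at this
    have h2 := hq _ (x - y : E).2 h1
    exact sub_eq_zero.1 (Subtype.ext h2 : (x - y : E) = 0)⟩
  have : FiniteDimensional 𝕜 (SeminormedCopy q') := inferInstanceAs (FiniteDimensional 𝕜 E)
  let T : SeminormedCopy q' →ₗ[𝕜] SeminormedCopy r :=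
    { toFun := E.subtype, map_add' := fun _ _ => rfl, map_smul' := fun _ _ => rfl }
  let T' : SeminormedCopy q' →L[𝕜] SeminormedCopy r := ⟨T, T.continuous_of_finiteDimensional⟩
  refine ⟨‖T'‖ + 1, by positivity, fun x hx => ?_⟩
  have h1 : r x ≤ ‖T'‖ * q x := T'.le_opNorm (⟨x, hx⟩ : E)
  have := apply_nonneg q x
  linarith

variable [SeminormedAddCommGroup H] [InnerProductSpace 𝕜 H]

/-- The scalar products of `A x` with the vectors `A (g i)`. -/
noncomputable def innerCoords (A : X →ₗ[𝕜] H) {m : ℕ} (g : Fin m → X) : X →ₗ[𝕜] (Fin m → 𝕜) :=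
  LinearMap.pi fun i => (innerₛₗ 𝕜 (A (g i))).comp A

theorem innerCoords_eq_zero_iff {A : X →ₗ[𝕜] H} {m : ℕ} {g : Fin m → X} {x : X} :
    innerCoords A g x = 0 ↔ ∀ i, inner 𝕜 (A (g i)) (A x) = 0 :=
  funext_iff

theorem inner_eq_zero_of_mem_span {A : X →ₗ[𝕜] H} {m : ℕ} {g : Fin m → X} {x y : X}
    (hx : ∀ i, inner 𝕜 (A (g i)) (A x) = 0) (hy : y ∈ Submodule.span 𝕜 (Set.range g)) :
    inner 𝕜 (A y) (A x) = 0 := by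
  obtain ⟨c, rfl⟩ := (Submodule.mem_span_range_iff_exists_fun 𝕜).1 hy
  simp [map_sum, sum_inner, inner_smul_left, hx]

theorem norm_le_norm_add_of_inner_eq_zero {u v : H} (h : inner 𝕜 u v = 0) : ‖u‖ ≤ ‖u + v‖ := by
  have h1 := norm_add_sq_eq_norm_sq_add_norm_sq_of_inner_eq_zero u v h
  nlinarith [norm_nonneg u, norm_nonneg v, norm_nonneg (u + v)]

/-- A subspace `E` of dimension larger than `n` contains a nonzero vector that is `p`-orthogonal
to a given `n`-dimensional subspace `L`; its `p`-distance to `L` is therefore its seminorm. -/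
theorem exists_mem_forall_le_of_finrank {p q : Seminorm 𝕜 X} (hp : IsHilbertSeminorm p)
    {E : Submodule 𝕜 X} {n : ℕ} {s : ℝ} (hn : n < Module.finrank 𝕜 E)
    (hq : ∀ x ∈ E, q x = 0 → x = 0) (hs : ∀ x ∈ E, s * q x ≤ p x)
    {L : Submodule 𝕜 X} (hL : Module.rank 𝕜 L ≤ n) :
    ∃ x ∈ E, q x ≤ 1 ∧ ∀ l ∈ L, s ≤ p (x - l) := by
  obtain ⟨H, _, _, A, rfl⟩ := hp.exists_linearMap
  have hLlt : Module.rank 𝕜 L < Cardinal.aleph0 := hL.trans_lt (Cardinal.natCast_lt_aleph0)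
  have : FiniteDimensional 𝕜 L := Module.rank_lt_aleph0_iff.1 hLlt
  have : FiniteDimensional 𝕜 E := Module.finite_of_finrank_pos (by omega)
  set b := Module.finBasis 𝕜 L with hb
  let g : Fin (Module.finrank 𝕜 L) → X := fun i => b i
  have hg : Submodule.span 𝕜 (Set.range g) = L := by
    have : Set.range g = L.subtype '' Set.range b := by rw [← Set.range_comp]; rfl
    rw [this, ← Submodule.map_span, b.span_eq, Submodule.map_top, Submodule.range_subtype]
  have hd : Module.finrank 𝕜 L ≤ n := by
    rw [← Module.finrank_eq_rank] at hL
    exact_mod_cast hL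
  obtain ⟨x, hx, hx0⟩ := Submodule.exists_mem_ne_zero_of_ne_bot
    (LinearMap.ker_ne_bot_of_finrank_lt (f := (innerCoords A g).domRestrict E)
      (by rw [Module.finrank_fin_fun]; omega))
  have hxA : ∀ i, inner 𝕜 (A (g i)) (A x) = 0 := innerCoords_eq_zero_iff.1 hx
  have hqx : q x ≠ 0 := fun h => hx0 (Subtype.ext (hq _ x.2 h))
  have hqpos : 0 < q x := lt_of_le_of_ne (apply_nonneg q _) hqx.symm
  set r : 𝕜 := (((q x)⁻¹ : ℝ) : 𝕜) with hr
  have hnr : ‖r‖ = (q x)⁻¹ := by rw [hr, RCLike.norm_ofReal, abs_of_pos (by positivity)]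
  have hq1 : q (r • (x : X)) = 1 := by
    rw [map_smul_eq_mul, hnr, inv_mul_cancel₀ hqx]
  refine ⟨r • (x : X), E.smul_mem _ x.2, hq1.le, fun l hl => ?_⟩
  have h1 := hs _ (E.smul_mem r x.2)
  rw [hq1, mul_one] at h1
  refine h1.trans ?_
  change ‖A _‖ ≤ ‖A _‖
  rw [sub_eq_add_neg, map_add]
  refine norm_le_norm_add_of_inner_eq_zero (𝕜 := 𝕜) ?_
  rw [← inner_conj_symm, map_smul, inner_smul_right,
    inner_eq_zero_of_mem_span hxA (hg.symm ▸ L.neg_mem hl)]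
  simp

/-- The gain obtained from a precompact step `p₀ ≤ p₁`. On the complement of a
finite-dimensional space `F` the seminorm `p₁` is at least `ε⁻¹ • p₀`. Replacing the part of a
large subspace that is lost by passing to this complement by `F` itself keeps the dimension, so
that there is no loss in the index `n`. -/
theorem IsPrecompactFor.hasLargeSubspace_gain {p₀ p₁ r : Seminorm 𝕜 X}
    (hp₁ : IsHilbertSeminorm p₁) (h₀₁ : p₀ ≤ p₁) (h₁r : p₁ ≤ r) (h : IsPrecompactFor p₀ p₁)
    {ε : ℝ} (hε : 0 < ε) :
    ∃ s₀ : ℝ, 0 < s₀ ∧ ∀ (n : ℕ) (s : ℝ), 0 < s → s ≤ s₀ →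
      HasLargeSubspace p₀ r n s → HasLargeSubspace p₁ r n (s / (2 * ε)) := by
  obtain ⟨H, _, _, B, rfl⟩ := hp₁.exists_linearMap
  obtain ⟨m, f, hf, hfs⟩ := h.exists_orthonormal (fun x => h₀₁ x) hε
  set F := Submodule.span 𝕜 (Set.range f) with hF
  have hFdim : Module.finrank 𝕜 F = m := by
    have hli : LinearIndependent 𝕜 f := LinearIndependent.of_comp B hf.linearIndependent
    rw [hF, finrank_span_eq_card hli, Fintype.card_fin]
  have hFfin : FiniteDimensional 𝕜 F := FiniteDimensional.span_of_finite 𝕜 (Set.finite_range f)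
  have hF0 : ∀ x ∈ F, (∀ i, inner 𝕜 (B (f i)) (B x) = 0) → x = 0 := fun x hx hxi => by
    obtain ⟨c, rfl⟩ := (Submodule.mem_span_range_iff_exists_fun 𝕜).1 hx
    refine Finset.sum_eq_zero fun i _ => ?_
    have h1 := hf.inner_right_fintype c i
    simp only [Function.comp_apply] at h1
    have h2 := hxi i
    simp only [map_sum, map_smul, h1] at h2
    rw [h2, zero_smul]
  have hFB : ∀ x ∈ F, ‖B x‖ = 0 → x = 0 := fun x hx hBx => by
    refine hF0 x hx fun i => norm_le_zero_iff.1 ?_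
    refine (norm_inner_le_norm _ _).trans ?_
    rw [hBx, mul_zero]
  obtain ⟨c, hc, hcF⟩ := exists_le_mul_of_finiteDimensional ((normSeminorm 𝕜 H).comp B) r F hFB
  -- `s ≤ ε / c` ensures that the bound `r ≤ (ε / s) • p₁`, valid on `N` below, also holds on `F`
  refine ⟨ε / c, by positivity, fun n s hs hsc ⟨E, hn, hEr, hEs⟩ => ?_⟩
  have : FiniteDimensional 𝕜 E := Module.finite_of_finrank_pos (by omega)
  let φ := (innerCoords B f).domRestrict E
  -- `N` is the intersection of `E` with the orthogonal complement of `F`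
  set N : Submodule 𝕜 X := (LinearMap.ker φ).map E.subtype with hN
  have hNE : ∀ x ∈ N, x ∈ E ∧ ∀ i, inner 𝕜 (B (f i)) (B x) = 0 := by
    rintro _ ⟨y, hy, rfl⟩
    exact ⟨y.2, innerCoords_eq_zero_iff.1 hy⟩
  have hNF : N ⊓ F = ⊥ := by
    rw [eq_bot_iff]
    rintro x ⟨hxN, hxF⟩
    exact hF0 x hxF (hNE x hxN).2
  have hdim : n < Module.finrank 𝕜 (N ⊔ F : Submodule 𝕜 X) := by
    have h1 := Submodule.finrank_sup_add_finrank_inf_eq N F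
    have h2 := φ.finrank_range_add_finrank_ker
    have h3 : Module.finrank 𝕜 (LinearMap.range φ) ≤ m := by
      simpa using (LinearMap.range φ).finrank_le
    have h4 : Module.finrank 𝕜 N = Module.finrank 𝕜 (LinearMap.ker φ) :=
      Submodule.finrank_map_subtype_eq _ _
    rw [hNF, finrank_bot] at h1
    omega
  have hNr : ∀ x ∈ N, r x ≤ ε / s * ‖B x‖ := fun x hx => by
    have h1 := hEs x (hNE x hx).1
    have h2 := hfs x (hNE x hx).2
    rw [div_mul_eq_mul_div, le_div_iff₀ hs]
    linarith
  have hcs : c ≤ ε / s := by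
    rw [le_div_iff₀ hs, mul_comm]
    rwa [le_div_iff₀ hc] at hsc
  have hFr : ∀ x ∈ F, r x ≤ ε / s * ‖B x‖ := fun x hx =>
    (hcF x hx).trans (mul_le_mul_of_nonneg_right hcs (norm_nonneg _))
  have horth : ∀ x ∈ N, ∀ y ∈ F, ‖B x‖ ≤ ‖B (x + y)‖ ∧ ‖B y‖ ≤ ‖B (x + y)‖ := fun x hx y hy => by
    have h1 : inner 𝕜 (B y) (B x) = 0 := inner_eq_zero_of_mem_span (hNE x hx).2 hy
    have h2 : inner 𝕜 (B x) (B y) = 0 := by rw [← inner_conj_symm, h1, map_zero]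
    rw [map_add]
    refine ⟨norm_le_norm_add_of_inner_eq_zero h2, ?_⟩
    rw [add_comm]
    exact norm_le_norm_add_of_inner_eq_zero h1
  refine ⟨N ⊔ F, hdim, fun z hz hrz => ?_, fun z hz => ?_⟩
  · obtain ⟨x, hx, y, hy, rfl⟩ := Submodule.mem_sup.1 hz
    obtain ⟨h1, h2⟩ := horth x hx y hy
    have hB : ‖B (x + y)‖ ≤ 0 := (h₁r (x + y)).trans hrz.le
    have hBx : ‖B x‖ = 0 := le_antisymm (h1.trans hB) (norm_nonneg _)
    have hBy : ‖B y‖ = 0 := le_antisymm (h2.trans hB) (norm_nonneg _)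
    have hx0 : x = 0 := hEr x (hNE x hx).1 (le_antisymm
      ((hNr x hx).trans (by rw [hBx, mul_zero])) (apply_nonneg r x))
    rw [hx0, hFB y hy hBy, add_zero]
  · obtain ⟨x, hx, y, hy, rfl⟩ := Submodule.mem_sup.1 hz
    obtain ⟨h1, h2⟩ := horth x hx y hy
    change _ ≤ ‖B (x + y)‖
    have h3 : r (x + y) ≤ ε / s * (2 * ‖B (x + y)‖) := by
      have h4 : ε / s * ‖B x‖ + ε / s * ‖B y‖ ≤ ε / s * (2 * ‖B (x + y)‖) := by
        rw [← mul_add]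
        gcongr
        linarith
      linarith [map_add_le_add r x y, hNr x hx, hFr y hy]
    calc s / (2 * ε) * r (x + y) ≤ s / (2 * ε) * (ε / s * (2 * ‖B (x + y)‖)) := by gcongr
      _ = ‖B (x + y)‖ := by field_simp

end Subspaces

/-! ### Kolmogorov widths -/

section WidthLemmas

variable {𝕜 : Type*} [RCLike 𝕜] {X : Type*} [AddCommGroup X] [Module 𝕜 X] [Module ℝ X]
  {n : ℕ} {V V' U U' : Set X}

theorem kolmogorovWidth_le {δ : ℝ} (hδ : 0 < δ) {L : Submodule 𝕜 X} (hL : Module.rank 𝕜 L ≤ n)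
    (h : V ⊆ δ • U + (L : Set X)) : kolmogorovWidth 𝕜 n V U ≤ ENNReal.ofReal δ :=
  sInf_le ⟨δ, ⟨hδ, L, hL, h⟩, rfl⟩

theorem le_kolmogorovWidth {a : ℝ≥0∞} (h : ∀ δ : ℝ, 0 < δ → ∀ L : Submodule 𝕜 X,
    Module.rank 𝕜 L ≤ n → V ⊆ δ • U + (L : Set X) → a ≤ ENNReal.ofReal δ) :
    a ≤ kolmogorovWidth 𝕜 n V U := by
  refine le_sInf ?_
  rintro _ ⟨δ, ⟨hδ, L, hL, hV⟩, rfl⟩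
  exact h δ hδ L hL hV

theorem kolmogorovWidth_mono (hV : V ⊆ V') (hU : U' ⊆ U) :
    kolmogorovWidth 𝕜 n V U ≤ kolmogorovWidth 𝕜 n V' U' :=
  le_kolmogorovWidth fun _ hδ _ hL h => kolmogorovWidth_le hδ hL
    (hV.trans (h.trans (Set.add_subset_add (Set.smul_set_mono hU) subset_rfl)))

theorem kolmogorovWidth_le_of_subset_smul {δ : ℝ} (hδ : 0 < δ) (h : V ⊆ δ • U) :
    kolmogorovWidth 𝕜 n V U ≤ ENNReal.ofReal δ :=
  kolmogorovWidth_le (L := ⊥) hδ (by simp) (by simpa using h)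

theorem kolmogorovWidth_smul_le [IsScalarTower ℝ 𝕜 X] {r : ℝ} (hr : 0 < r) (h : V ⊆ r • V') :
    kolmogorovWidth 𝕜 n V U ≤ ENNReal.ofReal r * kolmogorovWidth 𝕜 n V' U := by
  rw [← ENNReal.div_le_iff' (by simpa using hr) ENNReal.ofReal_ne_top]
  refine le_kolmogorovWidth fun δ hδ L hL hV => ?_
  rw [ENNReal.div_le_iff' (by simpa using hr) ENNReal.ofReal_ne_top,
    ← ENNReal.ofReal_mul hr.le]
  refine kolmogorovWidth_le (by positivity) hL fun x hx => ?_
  obtain ⟨v, hv, rfl⟩ := h hx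
  obtain ⟨_, ⟨u, hu, rfl⟩, l, hl, rfl⟩ := hV hv
  refine ⟨(r * δ) • u, ⟨u, hu, rfl⟩, r • l, ?_, ?_⟩
  · rw [← algebraMap_smul 𝕜 r l]
    exact L.smul_mem _ hl
  · simp only [smul_add, mul_smul]

theorem map_real_smul [IsScalarTower ℝ 𝕜 X] (p : Seminorm 𝕜 X) (r : ℝ) (x : X) :
    p (r • x) = |r| * p x := by
  rw [← algebraMap_smul 𝕜 r x, map_smul_eq_mul, norm_algebraMap', Real.norm_eq_abs]

theorem mem_smul_setOf_le_one_iff [IsScalarTower ℝ 𝕜 X] (p : Seminorm 𝕜 X) {δ : ℝ} (hδ : 0 < δ)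
    {x : X} : x ∈ δ • {y | p y ≤ 1} ↔ p x ≤ δ := by
  rw [Set.mem_smul_set_iff_inv_smul_mem₀ hδ.ne']
  change p (δ⁻¹ • x) ≤ 1 ↔ _
  rw [map_real_smul, abs_of_pos (by positivity), inv_mul_le_iff₀ hδ, mul_one]

theorem subset_smul_setOf_le_one_add_iff [IsScalarTower ℝ 𝕜 X] (p : Seminorm 𝕜 X) {δ : ℝ}
    (hδ : 0 < δ) {L : Set X} :
    V ⊆ δ • {y | p y ≤ 1} + L ↔ ∀ x ∈ V, ∃ l ∈ L, p (x - l) ≤ δ := by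
  refine ⟨fun h x hx => ?_, fun h x hx => ?_⟩
  · obtain ⟨y, hy, l, hl, rfl⟩ := h hx
    exact ⟨l, hl, by simpa using (mem_smul_setOf_le_one_iff p hδ).1 hy⟩
  · obtain ⟨l, hl, hxl⟩ := h x hx
    exact ⟨x - l, (mem_smul_setOf_le_one_iff p hδ).2 hxl, l, hl, by simp⟩

theorem IsPrecompactFor.tendsto_kolmogorovWidth [IsScalarTower ℝ 𝕜 X] {p q : Seminorm 𝕜 X}
    (h : IsPrecompactFor p q) :
    Tendsto (fun n => kolmogorovWidth 𝕜 n {x | q x ≤ 1} {x | p x ≤ 1}) atTop (𝓝 0) := by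
  rw [ENNReal.tendsto_nhds_zero]
  intro ε hε
  obtain ⟨δ, hδ, hδε⟩ := ENNReal.lt_iff_exists_nnreal_btwn.1 hε
  have hδ' : (0 : ℝ) < δ := by exact_mod_cast hδ
  obtain ⟨F, hF⟩ := h δ hδ'
  filter_upwards [eventually_ge_atTop F.card] with n hn
  refine (kolmogorovWidth_le (L := Submodule.span 𝕜 (F : Set X)) hδ' ?_ ?_).trans
    ((ENNReal.ofReal_coe_nnreal).le.trans hδε.le)
  · exact (rank_span_finset_le F).trans (by exact_mod_cast hn)
  · rw [subset_smul_setOf_le_one_add_iff p hδ']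
    intro x hx
    obtain ⟨y, hy, hxy⟩ := hF x hx
    exact ⟨y, Submodule.subset_span hy, hxy⟩

/-- Large subspaces bound the widths from below: any set containing the `q`-unit ball of a subspace
`E` of dimension larger than `n`, on which `s • q ≤ p`, has `n`-th width at least `s`. -/
theorem ofReal_le_kolmogorovWidth [IsScalarTower ℝ 𝕜 X] {p q : Seminorm 𝕜 X}
    (hp : IsHilbertSeminorm p) {E : Submodule 𝕜 X} {s : ℝ} (hn : n < Module.finrank 𝕜 E)
    (hq : ∀ x ∈ E, q x = 0 → x = 0) (hs : ∀ x ∈ E, s * q x ≤ p x)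
    (hV : ∀ x ∈ E, q x ≤ 1 → x ∈ V) :
    ENNReal.ofReal s ≤ kolmogorovWidth 𝕜 n V {x | p x ≤ 1} := by
  refine le_kolmogorovWidth fun δ hδ L hL h => ENNReal.ofReal_le_ofReal ?_
  obtain ⟨x, hxE, hqx, hx⟩ := exists_mem_forall_le_of_finrank hp hn hq hs hL
  obtain ⟨l, hl, hxl⟩ := (subset_smul_setOf_le_one_add_iff p hδ).1 h x (hV x hxE hqx)
  exact (hx l hl).trans hxl

end WidthLemmas

/-! ### Neighbourhoods, bounded sets and the elementary inclusions -/

section Neighbourhoods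

variable {𝕜 : Type*} [RCLike 𝕜] {X : Type*} [AddCommGroup X] [Module 𝕜 X] [TopologicalSpace X]

theorem setOf_le_one_mem_nhds {p : Seminorm 𝕜 X} (hp : Continuous p) : {x | p x ≤ 1} ∈ 𝓝 (0 : X) :=
  hp.continuousAt.eventually_le_const (by simp)

variable [Module ℝ X]

theorem inter_mem_absConvexNhds {U V : Set X} (hU : U ∈ absConvexNhds 𝕜 X)
    (hV : V ∈ absConvexNhds 𝕜 X) : U ∩ V ∈ absConvexNhds 𝕜 X :=
  ⟨inter_mem hU.1 hV.1, hU.2.1.inter hV.2.1, hU.2.2.inter hV.2.2⟩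

variable [IsScalarTower ℝ 𝕜 X]

theorem setOf_le_one_mem_absConvexNhds {p : Seminorm 𝕜 X} (hp : Continuous p) :
    {x | p x ≤ 1} ∈ absConvexNhds 𝕜 X := by
  have h : {x | p x ≤ 1} = p.closedBall 0 1 := by ext; simp
  refine ⟨setOf_le_one_mem_nhds hp, ?_, ?_⟩ <;> rw [h]
  exacts [p.balanced_closedBall_zero 1, p.convex_closedBall 0 1]

theorem exists_subset_smul_of_isVonNBounded {B V : Set X} (hB : Bornology.IsVonNBounded 𝕜 B)
    (hV : V ∈ 𝓝 (0 : X)) : ∃ r : ℝ, 0 < r ∧ B ⊆ r • V := by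
  obtain ⟨r, hr, h⟩ := (hB hV).exists_pos
  refine ⟨r, hr, fun x hx => ?_⟩
  obtain ⟨v, hv, rfl⟩ := h (r : 𝕜) (by rw [RCLike.norm_ofReal]; exact le_abs_self r) hx
  exact ⟨v, hv, (algebraMap_smul 𝕜 r v).symm⟩

variable [ContinuousSMul 𝕜 X]

theorem exists_absConvexNhds_subset [LocallyConvexSpace ℝ X] {W : Set X} (hW : W ∈ 𝓝 (0 : X)) :
    ∃ U ∈ absConvexNhds 𝕜 X, U ⊆ W := by
  have : ContinuousSMul ℝ X := IsScalarTower.continuousSMul 𝕜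
  obtain ⟨s, ⟨hs, hsc⟩, hsW⟩ := (LocallyConvexSpace.convex_basis_zero ℝ X).mem_iff.1 hW
  refine ⟨convexHull ℝ (balancedCore 𝕜 s), ⟨?_, ?_, convex_convexHull _ _⟩,
    (convexHull_min (balancedCore_subset s) hsc).trans hsW⟩
  · exact mem_of_superset (balancedCore_mem_nhds_zero hs) (subset_convexHull ℝ _)
  · rintro a ha _ ⟨x, hx, rfl⟩
    have hconv : Convex ℝ {y : X | a • y ∈ convexHull ℝ (balancedCore 𝕜 s)} := by
      intro y hy z hz α β hα hβ hαβ
      change a • (α • y + β • z) ∈ convexHull ℝ (balancedCore 𝕜 s)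
      rw [smul_add, smul_comm a α, smul_comm a β]
      exact convex_convexHull ℝ _ hy hz hα hβ hαβ
    have hsub : balancedCore 𝕜 s ⊆ {y : X | a • y ∈ convexHull ℝ (balancedCore 𝕜 s)} :=
      fun y hy => subset_convexHull ℝ _ ((balancedCore_balanced s).smul_mem ha hy)
    exact convexHull_min hsub hconv hx

variable [IsTopologicalAddGroup X]

/-- The seminorm is twice the gauge, so that its closed unit ball lies in the given set. -/
theorem exists_seminorm_of_mem_absConvexNhds {U : Set X} (hU : U ∈ absConvexNhds 𝕜 X) :
    ∃ p : Seminorm 𝕜 X, Continuous p ∧ {x | p x ≤ 1} ⊆ U := by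
  have : ContinuousSMul ℝ X := IsScalarTower.continuousSMul 𝕜
  have habs : Absorbent ℝ U := absorbent_nhds_zero hU.1
  set g : Seminorm 𝕜 X := gaugeSeminorm hU.2.1 hU.2.2 habs with hg
  have hgc : Continuous g := continuous_gauge hU.2.2 hU.1
  refine ⟨g + g, hgc.add hgc, fun x hx => ?_⟩
  have hx : g x + g x ≤ 1 := hx
  refine setOfPred_gauge_lt_one_subset_self hU.2.2 (mem_of_mem_nhds hU.1) habs ?_
  change g x < 1
  linarith

theorem exists_seminorm_of_mem_nhds [LocallyConvexSpace ℝ X] {W : Set X} (hW : W ∈ 𝓝 (0 : X)) :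
    ∃ p : Seminorm 𝕜 X, Continuous p ∧ {x | p x ≤ 1} ⊆ W := by
  obtain ⟨U, hU, hUW⟩ := exists_absConvexNhds_subset (𝕜 := 𝕜) hW
  obtain ⟨p, hp, hpU⟩ := exists_seminorm_of_mem_absConvexNhds hU
  exact ⟨p, hp, hpU.trans hUW⟩

theorem IsSchwartzSpace.exists_isPrecompactFor (hX : IsSchwartzSpace 𝕜 X) {p : Seminorm 𝕜 X}
    (hp : Continuous p) : ∃ q : Seminorm 𝕜 X, Continuous q ∧ IsPrecompactFor p q := by
  obtain ⟨V, hV, -, hVp⟩ := hX _ (setOf_le_one_mem_absConvexNhds hp)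
  obtain ⟨q, hq, hqV⟩ := exists_seminorm_of_mem_absConvexNhds hV
  refine ⟨q, hq, fun ε hε => ?_⟩
  obtain ⟨F, hF, hVF⟩ := hVp ε hε
  refine ⟨hF.toFinset, fun x hx => ?_⟩
  obtain ⟨y, hy, z, hz, rfl⟩ := hVF (hqV hx)
  refine ⟨y, by simpa using hy, ?_⟩
  simpa using (mem_smul_setOf_le_one_iff p hε).1 hz

/-- In a hilbertizable Schwartz space, Hilbert seminorms can be chosen above any continuous
seminorm `p` with unit ball precompact for `p`. -/
theorem exists_isHilbertSeminorm_isPrecompactFor (hH : IsHilbertizable 𝕜 X)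
    (hS : IsSchwartzSpace 𝕜 X) {p : Seminorm 𝕜 X} (hp : Continuous p) :
    ∃ q : Seminorm 𝕜 X, Continuous q ∧ IsHilbertSeminorm q ∧ p ≤ q ∧ IsPrecompactFor p q := by
  obtain ⟨r, hr, hpr⟩ := hS.exists_isPrecompactFor hp
  obtain ⟨q, hq, hqH, hle⟩ := hH (p ⊔ r) (hp.max hr)
  exact ⟨q, hq, hqH, le_sup_left.trans hle, hpr.mono le_rfl (le_sup_right.trans hle)⟩

end Neighbourhoods

section Inclusions

variable {𝕜 : Type*} [RCLike 𝕜] {X : Type*} [AddCommGroup X] [Module 𝕜 X] [Module ℝ X]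

theorem enorm_mul_kolmogorovWidth_ne_top {ξ : ℝ} {n : ℕ} {V U : Set X} {r : ℝ} (hr : 0 < r)
    (h : V ⊆ r • U) : ‖ξ‖ₑ * kolmogorovWidth 𝕜 n V U ≠ ∞ :=
  ENNReal.mul_ne_top enorm_ne_top
    (ne_top_of_le_ne_top ENNReal.ofReal_ne_top (kolmogorovWidth_le_of_subset_smul hr h))

variable [TopologicalSpace X]

theorem exists_forall_le_of_tendsto_zero {u : ℕ → ℝ≥0∞} (hu : ∀ n, u n ≠ ∞)
    (h : Tendsto u atTop (𝓝 0)) : ∃ C : ℝ≥0∞, C < ∞ ∧ ∀ n, u n ≤ C := by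
  obtain ⟨N, hN⟩ := eventually_atTop.1 (ENNReal.tendsto_nhds_zero.1 h 1 one_pos)
  refine ⟨1 + ∑ n ∈ Finset.range N, u n, ?_, fun n => ?_⟩
  · exact ENNReal.add_lt_top.2 ⟨ENNReal.one_lt_top,
      ENNReal.sum_lt_top.2 fun n _ => (hu n).lt_top⟩
  · rcases lt_or_ge n N with hn | hn
    · exact (Finset.single_le_sum (f := u) (fun _ _ => zero_le) (Finset.mem_range.2 hn)).trans
        le_add_self
    · exact (hN n hn).trans le_self_add

/-- Shrinking `V` to `V ∩ U` makes all widths finite, so that convergence implies boundedness. -/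
theorem diamDim_subset_diamDimInfty : diamDim 𝕜 X ⊆ diamDimInfty 𝕜 X := by
  intro ξ hξ U hU
  obtain ⟨V, hV, hVU⟩ := hξ U hU
  refine ⟨V ∩ U, inter_mem_absConvexNhds hV hU, exists_forall_le_of_tendsto_zero (fun n =>
    enorm_mul_kolmogorovWidth_ne_top one_pos (by simp)) ?_⟩
  refine tendsto_of_tendsto_of_tendsto_of_le_of_le tendsto_const_nhds hVU (fun _ => zero_le)
    fun n => ?_
  exact mul_le_mul_right (kolmogorovWidth_mono Set.inter_subset_left subset_rfl) _

variable [IsScalarTower ℝ 𝕜 X]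

theorem diamDim_subset_diamDimB : diamDim 𝕜 X ⊆ diamDimB 𝕜 X := by
  intro ξ hξ U hU B hB
  obtain ⟨V, hV, hVU⟩ := hξ U hU
  obtain ⟨r, hr, hBV⟩ := exists_subset_smul_of_isVonNBounded hB hV.1
  have h := ENNReal.Tendsto.const_mul (a := ENNReal.ofReal r) hVU (Or.inr ENNReal.ofReal_ne_top)
  rw [mul_zero] at h
  refine tendsto_of_tendsto_of_tendsto_of_le_of_le tendsto_const_nhds h (fun _ => zero_le)
    fun n => ?_
  calc _ ≤ ‖ξ n‖ₑ * (ENNReal.ofReal r * kolmogorovWidth 𝕜 n V U) := by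
        gcongr; exact kolmogorovWidth_smul_le hr hBV
    _ = _ := by ring

theorem diamDimB_subset_diamDimBInfty : diamDimB 𝕜 X ⊆ diamDimBInfty 𝕜 X := by
  intro ξ hξ U hU B hB
  obtain ⟨r, hr, hBU⟩ := exists_subset_smul_of_isVonNBounded hB hU.1
  exact exists_forall_le_of_tendsto_zero
    (fun n => enorm_mul_kolmogorovWidth_ne_top hr hBU) (hξ U hU B hB)

theorem diamDimInfty_subset_diamDimBInfty : diamDimInfty 𝕜 X ⊆ diamDimBInfty 𝕜 X := by
  intro ξ hξ U hU B hB
  obtain ⟨V, hV, C, hC, hVU⟩ := hξ U hU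
  obtain ⟨r, hr, hBV⟩ := exists_subset_smul_of_isVonNBounded hB hV.1
  refine ⟨ENNReal.ofReal r * C, ENNReal.mul_lt_top ENNReal.ofReal_lt_top hC, fun n => ?_⟩
  calc _ ≤ ‖ξ n‖ₑ * (ENNReal.ofReal r * kolmogorovWidth 𝕜 n V U) := by
        gcongr; exact kolmogorovWidth_smul_le hr hBV
    _ = ENNReal.ofReal r * (‖ξ n‖ₑ * kolmogorovWidth 𝕜 n V U) := by ring
    _ ≤ _ := by gcongr; exact hVU n

end Inclusions

section BoundedUnion

variable {𝕜 : Type*} [RCLike 𝕜] {X : Type*} [AddCommGroup X] [Module 𝕜 X] [TopologicalSpace X]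

/-- If `P` is an increasing fundamental sequence of seminorms, then the union of the `P k`-unit
balls of finite-dimensional subspaces `E k` is bounded: for each `j` only the finitely many
sets with `k < j` are not contained in the unit ball of `P j`. -/
theorem isVonNBounded_iUnion_unitBall {P : ℕ → Seminorm 𝕜 X} (hP : Monotone P)
    (hbasis : ∀ W ∈ 𝓝 (0 : X), ∃ j, {x | P j x ≤ 1} ⊆ W) {E : ℕ → Submodule 𝕜 X}
    (hfin : ∀ k, FiniteDimensional 𝕜 (E k)) (hE : ∀ k, ∀ x ∈ E k, P k x = 0 → x = 0) :
    Bornology.IsVonNBounded 𝕜 {x | ∃ k, x ∈ E k ∧ P k x ≤ 1} := by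
  intro W hW
  obtain ⟨j, hj⟩ := hbasis W hW
  choose C hC hCE using fun k => exists_le_mul_of_finiteDimensional (P k) (P j) (E k) (hE k)
  set R := 1 + ∑ k ∈ Finset.range j, C k with hR
  have hR1 : 1 ≤ R := le_add_of_nonneg_right (Finset.sum_nonneg fun k _ => (hC k).le)
  have hbound : ∀ x, (∃ k, x ∈ E k ∧ P k x ≤ 1) → P j x ≤ R := by
    rintro x ⟨k, hxE, hx⟩
    rcases lt_or_ge k j with hk | hk
    · have h1 := hCE k x hxE
      have h2 : C k ≤ ∑ k ∈ Finset.range j, C k :=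
        Finset.single_le_sum (f := C) (fun k _ => (hC k).le) (Finset.mem_range.2 hk)
      nlinarith [hC k]
    · exact ((hP hk x).trans hx).trans hR1
  rw [absorbs_iff_norm]
  refine ⟨R, fun c hc x hx => ?_⟩
  have hc0 : 0 < ‖c‖ := by linarith
  refine ⟨c⁻¹ • x, hj ?_, smul_inv_smul₀ (norm_pos_iff.1 hc0) x⟩
  change P j (c⁻¹ • x) ≤ 1
  rw [map_smul_eq_mul, norm_inv, inv_mul_le_iff₀ hc0, mul_one]
  exact (hbound x hx).trans hc

end BoundedUnion

/-! ### Hilbertizable Schwartz spaces -/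

section HilbertizableSchwartz

variable {𝕜 : Type*} [RCLike 𝕜] {X : Type*} [AddCommGroup X] [Module 𝕜 X] [Module ℝ X]
  [IsScalarTower ℝ 𝕜 X]

/-- If `ξ n` times the widths does not tend to `0` for `p₀`, then `ξ n` times the lower bounds of
the widths coming from large subspaces is unbounded for `p₁`. -/
theorem exists_hasLargeSubspace_of_not_tendsto {p₀ p₁ r : Seminorm 𝕜 X}
    (hp₀ : IsHilbertSeminorm p₀) (hp₁ : IsHilbertSeminorm p₁) (hr : IsHilbertSeminorm r)
    (h₀₁ : p₀ ≤ p₁) (h₁r : p₁ ≤ r) (h : IsPrecompactFor p₀ p₁) {ξ : ℕ → ℝ}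
    (hξ : ¬ Tendsto (fun n => ‖ξ n‖ₑ * kolmogorovWidth 𝕜 n {x | r x ≤ 1} {x | p₀ x ≤ 1})
      atTop (𝓝 0)) {R : ℝ} (hR : 0 < R) :
    ∃ (n : ℕ) (s : ℝ), R < |ξ n| * s ∧ HasLargeSubspace p₁ r n s := by
  rw [ENNReal.tendsto_nhds_zero] at hξ
  push Not at hξ
  obtain ⟨ε, hε, hfreq⟩ := hξ
  obtain ⟨e, he, heε⟩ := ENNReal.lt_iff_exists_nnreal_btwn.1 hε
  have he' : (0 : ℝ) < e := by exact_mod_cast he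
  have hpre : IsPrecompactFor p₀ r := h.mono le_rfl h₁r
  obtain ⟨s₀, hs₀, hgain⟩ := h.hasLargeSubspace_gain hp₁ h₀₁ h₁r
    (ε := (e : ℝ) / (8 * R)) (by positivity)
  -- precompactness makes the widths eventually so small that the gain applies
  have hsmall : ∀ᶠ n in atTop, kolmogorovWidth 𝕜 n {x | r x ≤ 1} {x | p₀ x ≤ 1}
      ≤ ENNReal.ofReal s₀ :=
    ENNReal.tendsto_nhds_zero.1 hpre.tendsto_kolmogorovWidth _ (ENNReal.ofReal_pos.2 hs₀)
  obtain ⟨n, hn, hns⟩ := (hfreq.and_eventually hsmall).exists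
  set w := kolmogorovWidth 𝕜 n {x | r x ≤ 1} {x | p₀ x ≤ 1} with hw
  have hwtop : w ≠ ∞ := ne_top_of_le_ne_top ENNReal.ofReal_ne_top hns
  have hωs : w.toReal ≤ s₀ := ENNReal.toReal_le_of_le_ofReal hs₀.le hns
  have hprod : (e : ℝ) < |ξ n| * w.toReal := by
    have h1 : (e : ℝ≥0∞) < ‖ξ n‖ₑ * w := heε.trans hn
    have h2 := (ENNReal.toReal_lt_toReal ENNReal.coe_ne_top
      (ENNReal.mul_ne_top enorm_ne_top hwtop)).2 h1
    simpa using h2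
  have hω : 0 < w.toReal := by
    refine lt_of_le_of_ne ENNReal.toReal_nonneg fun h0 => ?_
    rw [← h0, mul_zero] at hprod
    linarith
  refine ⟨n, w.toReal / 4 / (2 * (e / (8 * R))), ?_, hgain n _ (by positivity) (by linarith) ?_⟩
  · have h1 : |ξ n| * (w.toReal / 4 / (2 * (e / (8 * R)))) = |ξ n| * w.toReal * (R / e) := by
      field_simp
      ring
    rw [h1]
    calc R = e * (R / e) := by field_simp
      _ < _ := by gcongr
  · rcases hpre.hasLargeSubspace_or hp₀ hr (h₀₁.trans h₁r) n
      (by positivity : 0 < w.toReal / 4) with hL | ⟨L, hL, hLx⟩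
    · exact hL
    · -- here the width would be at most half of itself
      exfalso
      have h1 : w ≤ ENNReal.ofReal (2 * (w.toReal / 4)) :=
        kolmogorovWidth_le (by positivity) hL
          ((subset_smul_setOf_le_one_add_iff p₀ (by positivity)).2 hLx)
      have h2 := ENNReal.toReal_le_of_le_ofReal (by positivity) h1
      linarith

variable [TopologicalSpace X] [IsTopologicalAddGroup X] [ContinuousSMul 𝕜 X]
  [LocallyConvexSpace ℝ X] [FirstCountableTopology X]

/-- In a first countable hilbertizable space there is an increasing fundamental sequence of
continuous Hilbert seminorms above a given continuous seminorm. -/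
theorem exists_fundamental_sequence (hH : IsHilbertizable 𝕜 X) {p : Seminorm 𝕜 X}
    (hp : Continuous p) : ∃ P : ℕ → Seminorm 𝕜 X, (∀ k, Continuous (P k)) ∧
      (∀ k, IsHilbertSeminorm (P k)) ∧ (∀ k, p ≤ P k) ∧ Monotone P ∧
      ∀ W ∈ 𝓝 (0 : X), ∃ j, {x | P j x ≤ 1} ⊆ W := by
  obtain ⟨W, hW⟩ := (𝓝 (0 : X)).exists_antitone_basis
  choose g hg hgW using fun k =>
    exists_seminorm_of_mem_nhds (𝕜 := 𝕜) (hW.1.mem_of_mem (i := k) trivial)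
  choose! F hFc hFH hF using hH
  let P : ℕ → Seminorm 𝕜 X := fun k =>
    Nat.rec (F (p ⊔ g 0)) (fun k q => F (q ⊔ g (k + 1))) k
  have hP0 : P 0 = F (p ⊔ g 0) := rfl
  have hPs : ∀ k, P (k + 1) = F (P k ⊔ g (k + 1)) := fun k => rfl
  have hPc : ∀ k, Continuous (P k) := fun k => by
    induction k with
    | zero => exact hFc _ (hp.max (hg 0))
    | succ k ih => exact hFc _ (ih.max (hg (k + 1)))
  have hmono : Monotone P := monotone_nat_of_le_succ fun k =>
    le_sup_left.trans (hF _ ((hPc k).max (hg (k + 1))))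
  have hgP : ∀ k, g k ≤ P k := fun k => by
    cases k with
    | zero => exact le_sup_right.trans (hF _ (hp.max (hg 0)))
    | succ k => exact le_sup_right.trans (hF _ ((hPc k).max (hg (k + 1))))
  refine ⟨P, hPc, fun k => ?_, fun k => ?_, hmono, fun V hV => ?_⟩
  · cases k with
    | zero => exact hFH _ (hp.max (hg 0))
    | succ k => exact hFH _ ((hPc k).max (hg (k + 1)))
  · exact (le_sup_left.trans (hF _ (hp.max (hg 0)))).trans (hmono (Nat.zero_le k))
  · obtain ⟨j, -, hj⟩ := hW.1.mem_iff.1 hV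
    exact ⟨j, fun x hx => hj (hgW j ((hgP j x).trans hx))⟩

/-- A sequence outside `Δ` is also outside `Δ_b^∞`: the finite-dimensional unit balls that witness
the former for the neighbourhoods of a fundamental sequence have a bounded union. -/
theorem diamDimBInfty_subset_diamDim (hH : IsHilbertizable 𝕜 X) (hS : IsSchwartzSpace 𝕜 X) :
    diamDimBInfty 𝕜 X ⊆ diamDim 𝕜 X := by
  intro ξ hξ U hU
  by_contra! hcon
  obtain ⟨q, hq, hqU⟩ := exists_seminorm_of_mem_absConvexNhds hU
  obtain ⟨p₀, hp₀, hp₀H, hqp₀⟩ := hH q hq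
  have hp₀U : {x | p₀ x ≤ 1} ⊆ U := fun x hx => hqU ((hqp₀ x).trans hx)
  obtain ⟨p₁, hp₁, hp₁H, h₀₁, hpre⟩ := exists_isHilbertSeminorm_isPrecompactFor hH hS hp₀
  obtain ⟨P, hPc, hPH, hpP, hmono, hbasis⟩ := exists_fundamental_sequence hH hp₁
  have key : ∀ k : ℕ, ∃ (n : ℕ) (s : ℝ), (k + 1 : ℝ) < |ξ n| * s ∧
      HasLargeSubspace p₁ (P k) n s := fun k => by
    refine exists_hasLargeSubspace_of_not_tendsto hp₀H hp₁H (hPH k) h₀₁ (hpP k) hpre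
      (fun hT => hcon _ (setOf_le_one_mem_absConvexNhds (hPc k)) ?_) (by positivity)
    refine tendsto_of_tendsto_of_tendsto_of_le_of_le tendsto_const_nhds hT (fun _ => zero_le)
      fun n => ?_
    exact mul_le_mul_right (kolmogorovWidth_mono subset_rfl hp₀U) _
  choose n s hns E hnE hE hEs using key
  have hfin : ∀ k, FiniteDimensional 𝕜 (E k) := fun k =>
    Module.finite_of_finrank_pos ((Nat.zero_le _).trans_lt (hnE k))
  obtain ⟨C, hC, hCξ⟩ := hξ _ (setOf_le_one_mem_absConvexNhds hp₁) _
    (isVonNBounded_iUnion_unitBall hmono hbasis hfin hE)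
  obtain ⟨k, hk⟩ := ENNReal.exists_nat_gt hC.ne
  have h1 := ofReal_le_kolmogorovWidth hp₁H (hnE k) (hE k) (hEs k)
    (V := {x | ∃ k, x ∈ E k ∧ P k x ≤ 1}) (fun x hx hx1 => ⟨k, hx, hx1⟩)
  have h2 : ‖ξ (n k)‖ₑ * ENNReal.ofReal (s k) ≤ C := le_trans (by gcongr) (hCξ (n k))
  rw [← ofReal_norm, ← ENNReal.ofReal_mul (norm_nonneg _), Real.norm_eq_abs] at h2
  have h3 : (k : ℝ≥0∞) ≤ ENNReal.ofReal (|ξ (n k)| * s k) := by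
    rw [← ENNReal.ofReal_natCast]
    exact ENNReal.ofReal_le_ofReal (by linarith [hns k])
  exact absurd (h3.trans h2) (not_le.2 hk)

theorem diamDim_eq_of_isHilbertizable_of_isSchwartzSpace (hH : IsHilbertizable 𝕜 X)
    (hS : IsSchwartzSpace 𝕜 X) : diamDim 𝕜 X = diamDimB 𝕜 X ∧
      diamDimB 𝕜 X = diamDimInfty 𝕜 X ∧ diamDimInfty 𝕜 X = diamDimBInfty 𝕜 X := by
  have h := diamDimBInfty_subset_diamDim hH hS
  have hB : diamDim 𝕜 X = diamDimB 𝕜 X :=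
    diamDim_subset_diamDimB.antisymm (diamDimB_subset_diamDimBInfty.trans h)
  have hI : diamDim 𝕜 X = diamDimInfty 𝕜 X :=
    diamDim_subset_diamDimInfty.antisymm (diamDimInfty_subset_diamDimBInfty.trans h)
  refine ⟨hB, hB.symm.trans hI, diamDimInfty_subset_diamDimBInfty.antisymm (h.trans ?_)⟩
  exact diamDim_subset_diamDimInfty

end HilbertizableSchwartz

/-! ### Nuclear spaces -/

section NuclearSpaces

variable {𝕜 : Type*} [RCLike 𝕜] {X : Type*} [AddCommGroup X] [Module 𝕜 X]

/-- A representation `p ≤ ∑ c j * ‖φ j‖` with `∑ c j < ∞` and functionals `φ j` that are bounded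
by `q`. -/
theorem IsNuclearMap.exists_le_tsum {p q : Seminorm 𝕜 X} {h : p ≤ q}
    (hT : IsNuclearMap (canonicalMap h)) :
    ∃ (c : ℕ → ℝ) (φ : ℕ → X →ₗ[𝕜] 𝕜), (∀ j, 0 ≤ c j) ∧ Summable c ∧
      (∀ j x, ‖φ j x‖ ≤ q x) ∧ ∀ x, p x ≤ ∑' j, c j * ‖φ j x‖ := by
  obtain ⟨a, y, hsum, hay⟩ := hT
  let ι : X →ₗ[𝕜] LocalBanach q :=
    { toFun := fun x => ((show SeminormedCopy q from x) : LocalBanach q)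
      map_add' := fun x y => UniformSpace.Completion.coe_add (α := SeminormedCopy q) x y
      map_smul' := fun r x => UniformSpace.Completion.coe_smul (X := SeminormedCopy q) r x }
  have hι : ∀ x, ‖ι x‖ = q x := fun x =>
    UniformSpace.Completion.norm_coe (E := SeminormedCopy q) x
  have hai : ∀ j x, ‖a j (ι x)‖ ≤ ‖a j‖ * q x := fun j x => by
    rw [← hι]; exact (a j).le_opNorm _
  refine ⟨fun j => ‖a j‖ * ‖y j‖, fun j => ((‖a j‖⁻¹ : ℝ) : 𝕜) • (a j).toLinearMap.comp ι,
    fun j => by positivity, hsum, fun j x => ?_, fun x => ?_⟩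
  · have h1 : ‖(((‖a j‖⁻¹ : ℝ) : 𝕜) • (a j).toLinearMap.comp ι) x‖ = ‖a j‖⁻¹ * ‖a j (ι x)‖ := by
      simp
    rw [h1]
    rcases eq_or_lt_of_le (norm_nonneg (a j)) with h0 | h0
    · rw [← h0, inv_zero, zero_mul]; exact apply_nonneg q x
    · rw [inv_mul_le_iff₀ h0]; exact hai j x
  · have h1 : ∀ j, ‖a j‖ * ‖y j‖ * ‖(((‖a j‖⁻¹ : ℝ) : 𝕜) • (a j).toLinearMap.comp ι) x‖
        = ‖a j (ι x) • y j‖ := fun j => by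
      have h2 : ‖(((‖a j‖⁻¹ : ℝ) : 𝕜) • (a j).toLinearMap.comp ι) x‖
          = ‖a j‖⁻¹ * ‖a j (ι x)‖ := by simp
      rw [h2, norm_smul]
      rcases eq_or_lt_of_le (norm_nonneg (a j)) with h0 | h0
      · have h3 : ‖a j (ι x)‖ = 0 := by
          refine le_antisymm ((hai j x).trans ?_) (norm_nonneg _)
          rw [← h0, zero_mul]
        rw [h3]; simp
      · field_simp
    simp only [h1]
    have hs : Summable fun j => ‖a j (ι x) • y j‖ := by
      refine Summable.of_nonneg_of_le (fun _ => norm_nonneg _) (fun j => ?_) (hsum.mul_right (q x))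
      rw [norm_smul]
      calc _ ≤ ‖a j‖ * q x * ‖y j‖ := by gcongr; exact hai j x
        _ = _ := by ring
    have h2 : p x = ‖canonicalMap h (ι x)‖ := by
      have h3 : canonicalMap h (ι x) = _ := canonicalMap_coe h x
      rw [h3]
      exact (UniformSpace.Completion.norm_coe (E := SeminormedCopy p) _).symm
    rw [h2, ← (hay (ι x)).tsum_eq]
    exact norm_tsum_le_tsum_norm hs

theorem isHilbertSeminorm_comp {H : Type*} [SeminormedAddCommGroup H] [InnerProductSpace 𝕜 H]
    (A : X →ₗ[𝕜] H) : IsHilbertSeminorm ((normSeminorm 𝕜 H).comp A) :=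
  ⟨{ inner := fun x y => inner 𝕜 (A x) (A y)
     conj_inner_symm := fun x y => inner_conj_symm _ _
     re_inner_nonneg := fun x => inner_self_nonneg
     add_left := fun x y z => by simp only [map_add, inner_add_left]
     smul_left := fun x y r => by simp only [map_smul, inner_smul_left] },
    fun x => (inner_self_eq_norm_sq (𝕜 := 𝕜) (A x)).symm⟩

theorem summable_mul_norm_of_le {c : ℕ → ℝ} {φ : ℕ → X →ₗ[𝕜] 𝕜} {q : Seminorm 𝕜 X}
    (hc : ∀ j, 0 ≤ c j) (hs : Summable c) (hφ : ∀ j x, ‖φ j x‖ ≤ q x) (x : X) :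
    Summable fun j => c j * ‖φ j x‖ :=
  Summable.of_nonneg_of_le (fun j => mul_nonneg (hc j) (norm_nonneg _))
    (fun j => mul_le_mul_of_nonneg_left (hφ j x) (hc j)) (hs.mul_right (q x))

/-- By the Cauchy-Schwarz inequality, `∑ c j * ‖φ j x‖` is at most the Hilbert seminorm
`((∑ c j) * ∑ c j * ‖φ j x‖ ^ 2) ^ (1 / 2)`, which in turn is at most `(∑ c j) * q x`. -/
theorem exists_isHilbertSeminorm_between {c : ℕ → ℝ} {φ : ℕ → X →ₗ[𝕜] 𝕜} {q : Seminorm 𝕜 X}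
    (hc : ∀ j, 0 ≤ c j) (hs : Summable c) (hφ : ∀ j x, ‖φ j x‖ ≤ q x) :
    ∃ r : Seminorm 𝕜 X, IsHilbertSeminorm r ∧ (∀ x, ∑' j, c j * ‖φ j x‖ ≤ r x) ∧
      ∀ x, r x ≤ (∑' j, c j) * q x := by
  set C := ∑' j, c j with hC
  have hC0 : 0 ≤ C := tsum_nonneg hc
  have hsq : ∀ x j, ‖((√(C * c j) : ℝ) : 𝕜) * φ j x‖ ^ 2 = C * (c j * ‖φ j x‖ ^ 2) := fun x j => by
    rw [norm_mul, RCLike.norm_ofReal, mul_pow, sq_abs, Real.sq_sqrt (mul_nonneg hC0 (hc j))]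
    ring
  have hle : ∀ x j, C * (c j * ‖φ j x‖ ^ 2) ≤ C * q x ^ 2 * c j := fun x j => by
    have h1 : ‖φ j x‖ ^ 2 ≤ q x ^ 2 := pow_le_pow_left₀ (norm_nonneg _) (hφ j x) 2
    calc _ ≤ C * (c j * q x ^ 2) :=
          mul_le_mul_of_nonneg_left (mul_le_mul_of_nonneg_left h1 (hc j)) hC0
      _ = _ := by ring
  have hsum : ∀ x, Summable fun j => C * (c j * ‖φ j x‖ ^ 2) := fun x =>
    Summable.of_nonneg_of_le (fun j => mul_nonneg hC0 (mul_nonneg (hc j) (sq_nonneg _))) (hle x)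
      (hs.mul_left _)
  have hmem : ∀ x, Memℓp (fun j => ((√(C * c j) : ℝ) : 𝕜) * φ j x) 2 := fun x => by
    refine memℓp_gen ?_
    simp only [ENNReal.toReal_ofNat, Real.rpow_ofNat, hsq]
    exact hsum x
  let A : X →ₗ[𝕜] lp (fun _ : ℕ => 𝕜) 2 :=
    { toFun := fun x => ⟨_, hmem x⟩
      map_add' := fun x y => lp.ext (funext fun j => by
        change ((√(C * c j) : ℝ) : 𝕜) * φ j (x + y) = ((√(C * c j) : ℝ) : 𝕜) * φ j x +
          ((√(C * c j) : ℝ) : 𝕜) * φ j y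
        rw [map_add, mul_add])
      map_smul' := fun r x => by ext j; simp [mul_left_comm] }
  have hA : ∀ x, ‖A x‖ ^ 2 = ∑' j, C * (c j * ‖φ j x‖ ^ 2) := fun x => by
    have h1 := lp.norm_rpow_eq_tsum (p := 2) (by norm_num) (A x)
    simp only [ENNReal.toReal_ofNat, Real.rpow_ofNat] at h1
    rw [h1]
    exact tsum_congr fun j => hsq x j
  refine ⟨(normSeminorm 𝕜 _).comp A, isHilbertSeminorm_comp A, fun x => ?_, fun x => ?_⟩
  · change _ ≤ ‖A x‖
    refine Real.tsum_le_of_sum_range_le (fun j => mul_nonneg (hc j) (norm_nonneg _)) fun N => ?_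
    refine le_of_sq_le_sq ?_ (norm_nonneg _)
    have h1 : (∑ j ∈ Finset.range N, c j * ‖φ j x‖) ^ 2 ≤
        (∑ j ∈ Finset.range N, c j) * ∑ j ∈ Finset.range N, c j * ‖φ j x‖ ^ 2 :=
      Finset.sum_sq_le_sum_mul_sum_of_sq_le_mul _ (fun j _ => hc j)
        (fun j _ => mul_nonneg (hc j) (sq_nonneg _)) fun j _ => le_of_eq (by ring)
    refine h1.trans ?_
    have h2 : (∑ j ∈ Finset.range N, c j) ≤ C := hs.sum_le_tsum _ fun j _ => hc j
    calc _ ≤ C * ∑ j ∈ Finset.range N, c j * ‖φ j x‖ ^ 2 :=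
          mul_le_mul_of_nonneg_right h2
            (Finset.sum_nonneg fun j _ => mul_nonneg (hc j) (sq_nonneg _))
      _ = ∑ j ∈ Finset.range N, C * (c j * ‖φ j x‖ ^ 2) := Finset.mul_sum _ _ _
      _ ≤ _ := by
          rw [hA]
          exact (hsum x).sum_le_tsum _ fun j _ =>
            mul_nonneg hC0 (mul_nonneg (hc j) (sq_nonneg _))
  · change ‖A x‖ ≤ _
    refine le_of_sq_le_sq ?_ (mul_nonneg hC0 (apply_nonneg q x))
    rw [hA]
    calc _ ≤ ∑' j, C * q x ^ 2 * c j := (hsum x).tsum_le_tsum (hle x) (hs.mul_left _)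
      _ = _ := by rw [tsum_mul_left]; ring

/-- Up to a small tail of the series, `p x` is controlled by finitely many of the scalars
`φ j x`, which range over a bounded and hence totally bounded set. -/
theorem isPrecompactFor_of_le_tsum {c : ℕ → ℝ} {φ : ℕ → X →ₗ[𝕜] 𝕜} {p q : Seminorm 𝕜 X}
    (hc : ∀ j, 0 ≤ c j) (hs : Summable c) (hφ : ∀ j x, ‖φ j x‖ ≤ q x)
    (hp : ∀ x, p x ≤ ∑' j, c j * ‖φ j x‖) : IsPrecompactFor p q := by
  classical
  intro ε hε
  set C := ∑' j, c j with hC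
  have hC0 : 0 ≤ C := tsum_nonneg hc
  obtain ⟨N, hN⟩ := ((tendsto_sum_nat_add c).eventually_lt_const
    (by positivity : 0 < ε / 4)).exists
  let Φ : X → (Fin N → 𝕜) := fun x i => φ i x
  have hbdd : Bornology.IsBounded (Φ '' {x | q x ≤ 1}) := by
    refine isBounded_iff_forall_norm_le.2 ⟨1, ?_⟩
    rintro _ ⟨x, hx, rfl⟩
    exact (pi_norm_le_iff_of_nonneg zero_le_one).2 fun i => (hφ i x).trans hx
  obtain ⟨t, hts, ht, hcov⟩ := Metric.finite_approx_of_totallyBounded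
    (hbdd.isCompact_closure.totallyBounded.subset subset_closure) (ε / (2 * (C + 1))) (by positivity)
  have hts' : ∀ z ∈ t, ∃ x, q x ≤ 1 ∧ Φ x = z := fun z hz => hts hz
  choose! g hg1 hg2 using hts'
  refine ⟨ht.toFinset.image g, fun x hx => ?_⟩
  obtain ⟨z, hzt, hxz⟩ := Set.mem_iUnion₂.1 (hcov ⟨x, hx, rfl⟩)
  refine ⟨g z, Finset.mem_image_of_mem _ (ht.mem_toFinset.2 hzt), (hp _).trans ?_⟩
  have hgz : q (g z) ≤ 1 := hg1 z hzt
  have hq2 : q (x - g z) ≤ 2 := (map_sub_le_add q x (g z)).trans (by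
    have : q x ≤ 1 := hx
    linarith)
  rw [← (summable_mul_norm_of_le hc hs hφ (x - g z)).sum_add_tsum_nat_add N]
  have h1 : ∑ j ∈ Finset.range N, c j * ‖φ j (x - g z)‖ ≤ ε / 2 := by
    calc _ ≤ ∑ j ∈ Finset.range N, c j * (ε / (2 * (C + 1))) := by
          refine Finset.sum_le_sum fun j hj => mul_le_mul_of_nonneg_left ?_ (hc j)
          have h2 : dist (Φ x) z < ε / (2 * (C + 1)) := hxz
          rw [← hg2 z hzt] at h2
          have h3 := (dist_le_pi_dist (Φ x) (Φ (g z)) ⟨j, Finset.mem_range.1 hj⟩).trans h2.le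
          rw [dist_eq_norm] at h3
          rw [map_sub]
          exact h3
      _ = (∑ j ∈ Finset.range N, c j) * (ε / (2 * (C + 1))) := (Finset.sum_mul _ _ _).symm
      _ ≤ (C + 1) * (ε / (2 * (C + 1))) := by
          gcongr
          linarith [hs.sum_le_tsum (Finset.range N) fun j _ => hc j]
      _ = ε / 2 := by field_simp
  have h2 : ∑' j, c (j + N) * ‖φ (j + N) (x - g z)‖ ≤ ε / 2 := by
    have hsN : Summable fun j => c (j + N) := (summable_nat_add_iff N).2 hs
    calc _ ≤ ∑' j, c (j + N) * 2 := by
          refine Summable.tsum_le_tsum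
            (fun j => mul_le_mul_of_nonneg_left ((hφ _ _).trans hq2) (hc _))
            ((summable_nat_add_iff N).2 (summable_mul_norm_of_le hc hs hφ (x - g z)))
            (hsN.mul_right 2)
      _ = (∑' j, c (j + N)) * 2 := tsum_mul_right
      _ ≤ _ := by linarith
  linarith

variable [TopologicalSpace X] [IsTopologicalAddGroup X]

theorem IsNuclearSpace.isHilbertizable (hX : IsNuclearSpace 𝕜 X) : IsHilbertizable 𝕜 X := by
  intro p hp
  obtain ⟨q, hpq, hq, hT⟩ := hX p hp
  obtain ⟨c, φ, hc, hs, hφ, hpφ⟩ := hT.exists_le_tsum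
  obtain ⟨r, hrH, hφr, hrq⟩ := exists_isHilbertSeminorm_between hc hs hφ
  refine ⟨r, ?_, hrH, fun x => (hpφ x).trans (hφr x)⟩
  let C : NNReal := ⟨∑' j, c j, tsum_nonneg hc⟩
  exact Seminorm.continuous_of_le (q := C • q) (hq.const_smul C) hrq

theorem IsNuclearSpace.isSchwartzSpace [ContinuousSMul 𝕜 X] [Module ℝ X]
    [IsScalarTower ℝ 𝕜 X] (hX : IsNuclearSpace 𝕜 X) : IsSchwartzSpace 𝕜 X := by
  intro U hU
  obtain ⟨p, hp, hpU⟩ := exists_seminorm_of_mem_absConvexNhds hU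
  obtain ⟨q, hpq, hq, hT⟩ := hX p hp
  obtain ⟨c, φ, hc, hs, hφ, hpφ⟩ := hT.exists_le_tsum
  refine ⟨{x | q x ≤ 1}, setOf_le_one_mem_absConvexNhds hq,
    fun x hx => hpU ((hpq x).trans hx), fun ε hε => ?_⟩
  obtain ⟨F, hF⟩ := isPrecompactFor_of_le_tsum hc hs hφ hpφ ε hε
  refine ⟨F, F.finite_toSet, fun x hx => ?_⟩
  obtain ⟨y, hy, hxy⟩ := hF x hx
  exact ⟨y, hy, x - y, Set.smul_set_mono hpU ((mem_smul_setOf_le_one_iff p hε).2 hxy), by simp⟩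

end NuclearSpaces

end DiametralDimension

theorem mainTheorem1 {𝕜 : Type*} [RCLike 𝕜] {X : Type*} [AddCommGroup X]
    [Module 𝕜 X] [Module ℝ X] [IsScalarTower ℝ 𝕜 X]
    [UniformSpace X] [IsUniformAddGroup X] [ContinuousSMul 𝕜 X]
    [LocallyConvexSpace ℝ X] [TopologicalSpace.MetrizableSpace X] [CompleteSpace X] :
    (DiametralDimension.IsHilbertizable 𝕜 X → DiametralDimension.IsSchwartzSpace 𝕜 X →
      DiametralDimension.diamDim 𝕜 X = DiametralDimension.diamDimB 𝕜 X ∧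
      DiametralDimension.diamDimB 𝕜 X = DiametralDimension.diamDimInfty 𝕜 X ∧
      DiametralDimension.diamDimInfty 𝕜 X = DiametralDimension.diamDimBInfty 𝕜 X) ∧
    (DiametralDimension.IsNuclearSpace 𝕜 X →
      DiametralDimension.diamDim 𝕜 X = DiametralDimension.diamDimB 𝕜 X ∧
      DiametralDimension.diamDimB 𝕜 X = DiametralDimension.diamDimInfty 𝕜 X ∧
      DiametralDimension.diamDimInfty 𝕜 X = DiametralDimension.diamDimBInfty 𝕜 X) :=
  ⟨DiametralDimension.diamDim_eq_of_isHilbertizable_of_isSchwartzSpace, fun hX =>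
    DiametralDimension.diamDim_eq_of_isHilbertizable_of_isSchwartzSpace hX.isHilbertizable
      hX.isSchwartzSpace⟩
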